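/- Let $k$ be a finite field with algebraic closure $\bar k$, let $G$ be an algebraic group over $k$ (a group scheme of finite type over $k$), and let $X$ be a $k$-scheme with a left action of $G$. For a $k$-scheme $S$, let $[G\backslash X](S)$ be the category of pairs $(T,f)$, where $T$ is a (left, fppf) $G$-torsor over $S$ and $f\colon T\to X_S$ is a $G_S$-equivariant morphism over $S$; its morphisms $(T,f)\to(T',f')$ are the $G_S$-equivariant morphisms $\varphi\colon T\to T'$ over $S$ with $f'\circ\varphi=f$, and objects are pulled back along morphisms $S'\to S$ of $k$-schemes by base change. Let $C\in G(\bar k)\backslash X(\bar k)$ be an orbit, and let $P(C)$ be the corresponding isomorphism class in $[G\backslash X](\bar k)$, that is, the class of $(G_{\bar k},\, g\mapsto g\cdot x)$ for any $x\in C$. Then for every finite extension $k\subset k'\subset\bar k$ the following are equivalent: 1. $P(C)$ admits a model over $k'$, i.e. there is an object $(\tilde T,\tilde f)$ of $[G\backslash X](k')$ whose base change $(\tilde T,\tilde f)_{\bar k}$ lies in the isomorphism class $P(C)$; 2. $C$ is fixed under the natural action of $\mathrm{Gal}(\bar k/k')$ on $G(\bar k)\backslash X(\bar k)$. -/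

import Mathlib

open CategoryTheory AlgebraicGeometry Limits MonoidalCategory CartesianMonoidalCategory

open scoped MonObj

universe u v w

noncomputable section

namespace QuotStack

section Categorical

/-! ### Actions of group objects -/

variable {C : Type w} [Category.{v} C] [CartesianMonoidalCategory C]

/-- An action of a monoid object may be given by a morphism that satisfies the axioms of an action
on generalized points. -/
abbrev actionOfPoints {G T : C} [MonObj G] (a : G ⊗ T ⟶ T)
    (h_one : ∀ {Z : C} (t : Z ⟶ T), lift (1 : Z ⟶ G) t ≫ a = t)
    (h_mul : ∀ {Z : C} (g h : Z ⟶ G) (t : Z ⟶ T),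
      lift (g * h) t ≫ a = lift g (lift h t ≫ a) ≫ a) : ModObj G T where
  smul := a
  one_smul := by
    change η[G] ▷ T ≫ a = (λ_ T).hom
    have h := h_one (snd (𝟙_ C) T)
    rw [leftUnitor_hom, ← h]
    congr 1
    ext
    · simp only [whiskerRight_fst, lift_fst, Hom.one_def]
      congr 1
      exact toUnit_unique _ _
    · simp
  mul_smul := by
    change μ[G] ▷ T ≫ a = (α_ G G T).hom ≫ G ◁ a ≫ a
    have h := h_mul (fst (G ⊗ G) T ≫ fst G G) (fst (G ⊗ G) T ≫ snd G G) (snd (G ⊗ G) T)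
    convert h using 1
    · congr 1
      ext
      · simp [Hom.mul_def, ← comp_lift]
      · simp
    · rw [← Category.assoc]
      congr 1
      ext
      · simp
      · simp only [Category.assoc, whiskerLeft_snd, lift_snd]
        rw [← Category.assoc]
        congr 1
        ext <;> simp

/-- `G` acts on `G × S` by left multiplication on the first factor. -/
abbrev translationAction (G S : C) [MonObj G] : ModObj G (G ⊗ S) :=
  actionOfPoints (lift (fst G (G ⊗ S) * (snd G (G ⊗ S) ≫ fst G S)) (snd G (G ⊗ S) ≫ snd G S))
    (fun t ↦ by ext <;> simp [comp_lift, MonObj.comp_mul])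
    (fun g h t ↦ by ext <;> simp [comp_lift, MonObj.comp_mul, mul_assoc])

variable {G : C} [MonObj G]

/-- If `π : T ⟶ S` is invariant under `G`, then `G` acts on `T ×_S S'` through `T`. -/
abbrev pullbackAction {T S S' : C} [ModObj G T] (π : T ⟶ S) (s : S' ⟶ S) [HasPullback π s]
    (h : γ[G, T] ≫ π = snd G T ≫ π) : ModObj G (pullback π s) :=
  actionOfPoints
    (pullback.lift (fst G (pullback π s) • (snd G (pullback π s) ≫ pullback.fst π s))
      (snd G (pullback π s) ≫ pullback.snd π s)
      (by simp [Hom.smul_def, h, pullback.condition]))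
    (fun t ↦ by
      apply pullback.hom_ext
      · simp only [Category.assoc, pullback.lift_fst, ModObj.comp_smul, lift_fst, lift_snd_assoc,
          one_smul]
      · simp only [Category.assoc, pullback.lift_snd, lift_snd_assoc])
    (fun g h t ↦ by
      apply pullback.hom_ext
      · simp only [Category.assoc, pullback.lift_fst, ModObj.comp_smul, lift_fst, lift_snd_assoc,
          mul_smul]
      · simp only [Category.assoc, pullback.lift_snd, lift_snd_assoc])

/-- The square with sides `(g, t) ↦ g • t` and `(g, t) ↦ t` over `S` is cartesian iff `π` is
invariant and `G` acts simply transitively on the generalized points of its fibres. -/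
theorem isPullback_iff {T S : C} [ModObj G T] (π : T ⟶ S) :
    IsPullback γ[G, T] (snd G T) π π ↔ γ[G, T] ≫ π = snd G T ≫ π ∧
      ∀ {Z : C} (a b : Z ⟶ T), a ≫ π = b ≫ π → ∃! g : Z ⟶ G, g • b = a := by
  constructor
  · intro h
    refine ⟨h.w, fun {Z} a b hab ↦ ⟨h.lift a b hab ≫ fst G T, ?_, ?_⟩⟩
    · have : lift (h.lift a b hab ≫ fst G T) b = h.lift a b hab := by
        ext
        · simp
        · simp
      change lift _ _ ≫ _ = _
      rw [this]
      simp
    · intro g hg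
      have : lift g b = h.lift a b hab := by
        apply h.hom_ext
        · simpa [Hom.smul_def] using hg
        · simp
      rw [← this]
      simp
  · rintro ⟨hw, h⟩
    refine ⟨⟨hw⟩, ⟨PullbackCone.IsLimit.mk hw (fun s ↦ lift (h s.fst s.snd s.condition).choose s.snd)
      ?_ ?_ ?_⟩⟩
    · intro s
      exact (h s.fst s.snd s.condition).choose_spec.1
    · intro s
      simp
    · intro s m h₁ h₂
      apply CartesianMonoidalCategory.hom_ext (X := G) (Y := T)
      · rw [lift_fst]
        apply (h s.fst s.snd s.condition).choose_spec.2
        rw [← h₁, ← h₂, Hom.smul_def]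
        congr 1
        ext <;> simp
      · simpa using h₂


/-- Equivariance may be checked on generalized points. -/
theorem isModHom_of_points {T T' : C} [ModObj G T] [ModObj G T'] (f : T ⟶ T')
    (h : ∀ {Z : C} (g : Z ⟶ G) (t : Z ⟶ T), (g • t) ≫ f = g • (t ≫ f)) : IsModHom G f where
  smul_hom := by
    change γ[G, T] ≫ f = G ◁ f ≫ γ[G, T']
    have h' := h (fst G T) (snd G T)
    simp only [Hom.smul_def, lift_fst_snd, Category.id_comp] at h'
    rw [h']
    congr 1
    ext <;> simp

/-- Right translation by a point `g : S ⟶ G` is equivariant for left translations. -/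
theorem isModHom_translation {S : C} (g : S ⟶ G) :
    letI := translationAction G S
    IsModHom G (lift (fst G S * (snd G S ≫ g)) (snd G S)) := by
  let := translationAction G S
  refine isModHom_of_points _ fun {Z} h t ↦ ?_
  change (lift h t ≫ lift _ _) ≫ _ = lift h (t ≫ _) ≫ lift _ _
  ext <;> simp [MonObj.comp_mul, mul_assoc]

end Categorical

/-! ### Quotient stacks -/

section Stack

variable {k : Type u} [Field k]

/-- A `G`-torsor over a `k`-scheme `S`: a scheme `T` over `S` with a left action of `G` over `S`
such that `T → S` is flat, surjective and locally of finite presentation, and such that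
`G ×ₖ T → T ×_S T`, `(g, t) ↦ (g t, t)` is an isomorphism. The last condition is that the square
formed by the action, the projection and twice `π : T → S` is cartesian; in particular
`π (g t) = π t`, so that the action is one over `S`. -/
structure IsTorsor (G : Over (Spec (.of k))) [GrpObj G] {T S : Over (Spec (.of k))} [ModObj G T]
    (π : T ⟶ S) : Prop where
  flat : Flat π.left
  surjective : Surjective π.left
  locallyOfFinitePresentation : LocallyOfFinitePresentation π.left
  isPullback : IsPullback γ[G, T] (snd G T) π π

/-- An object over the `k`-scheme `S` of the quotient stack `[G \ X]`: a `G`-torsor `π : T → S`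
with a `G`-equivariant morphism `f : T → X` over `k`, which is the same thing as a
`G_S`-equivariant morphism `T → X_S = X ×ₖ S` over `S`. -/
structure QuotientStack (G X : Over (Spec (.of k))) [GrpObj G] [ModObj G X]
    (S : Over (Spec (.of k))) where
  /-- the total space of the torsor -/
  T : Over (Spec (.of k))
  /-- the action of `G` on the total space -/
  [action : ModObj G T]
  /-- the structure morphism of the torsor -/
  π : T ⟶ S
  torsor : IsTorsor G π
  /-- the equivariant morphism to `X` -/
  f : T ⟶ X
  [equivariant : IsModHom G f]

namespace QuotientStack

attribute [instance] action equivariant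

variable {G X : Over (Spec (.of k))} [GrpObj G] [ModObj G X] {S S' : Over (Spec (.of k))}

/-- Morphisms in the fibre of `[G \ X]` over `S`: equivariant morphisms over `S` of the torsors
that are compatible with the morphisms to `X`. -/
@[ext]
structure Hom (A B : QuotientStack G X S) where
  /-- the underlying morphism of schemes -/
  hom : A.T ⟶ B.T
  equivariant : IsModHom G hom
  hom_π : hom ≫ B.π = A.π
  hom_f : hom ≫ B.f = A.f

instance : Category (QuotientStack G X S) where
  Hom := Hom
  id A := ⟨𝟙 A.T, inferInstance, Category.id_comp _, Category.id_comp _⟩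
  comp φ ψ := ⟨φ.hom ≫ ψ.hom,
    have := φ.equivariant
    have := ψ.equivariant
    inferInstance,
    by rw [Category.assoc, ψ.hom_π, φ.hom_π], by rw [Category.assoc, ψ.hom_f, φ.hom_f]⟩
  id_comp _ := Hom.ext (Category.id_comp _)
  comp_id _ := Hom.ext (Category.comp_id _)
  assoc _ _ _ := Hom.ext (Category.assoc _ _ _)

/-- The set of isomorphism classes of the fibre of `[G \ X]` over `S`. -/
abbrev IsoClasses (G X : Over (Spec (.of k))) [GrpObj G] [ModObj G X]
    (S : Over (Spec (.of k))) : Type (u + 1) :=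
  Quotient (isIsomorphicSetoid (QuotientStack G X S))

/-- The pullback of `(T, f)` along `s : S' → S`: the torsor `T ×_S S'` over `S'` and the composite
of its projection to `T` with `f`. -/
def baseChange (A : QuotientStack G X S) (s : S' ⟶ S) : QuotientStack G X S' :=
  letI : ModObj G (pullback A.π s) := pullbackAction A.π s A.torsor.isPullback.w
  have smul_fst {Z : Over (Spec (.of k))} (g : Z ⟶ G) (t : Z ⟶ pullback A.π s) :
      (g • t) ≫ pullback.fst A.π s = g • (t ≫ pullback.fst A.π s) := by
    change (lift g t ≫ pullback.lift _ _ _) ≫ _ = _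
    simp only [Category.assoc, pullback.lift_fst, ModObj.comp_smul, lift_fst, lift_snd_assoc]
  have smul_snd {Z : Over (Spec (.of k))} (g : Z ⟶ G) (t : Z ⟶ pullback A.π s) :
      (g • t) ≫ pullback.snd A.π s = t ≫ pullback.snd A.π s := by
    change (lift g t ≫ pullback.lift _ _ _) ≫ _ = _
    simp only [Category.assoc, pullback.lift_snd, lift_snd_assoc]
  have sq : IsPullback (pullback.fst A.π s).left (pullback.snd A.π s).left A.π.left s.left :=
    (IsPullback.of_hasPullback A.π s).map (Over.forget _)
  have h_fst : IsModHom G (pullback.fst A.π s) := isModHom_of_points _ smul_fst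
  { T := pullback A.π s
    π := pullback.snd A.π s
    torsor :=
      { flat := MorphismProperty.of_isPullback (P := @Flat) sq A.torsor.flat
        surjective := MorphismProperty.of_isPullback (P := @Surjective) sq A.torsor.surjective
        locallyOfFinitePresentation := MorphismProperty.of_isPullback
          (P := @LocallyOfFinitePresentation) sq A.torsor.locallyOfFinitePresentation
        isPullback := by
          refine (isPullback_iff _).mpr ⟨?_, fun {Z} a b hab ↦ ?_⟩
          · have h := smul_snd (fst G (pullback A.π s)) (snd G (pullback A.π s))
            simpa only [Hom.smul_def, lift_fst_snd, Category.id_comp] using h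
          · obtain ⟨g, hg, hu⟩ := ((isPullback_iff _).mp A.torsor.isPullback).2
              (a ≫ pullback.fst A.π s) (b ≫ pullback.fst A.π s) (by
                rw [Category.assoc, Category.assoc, pullback.condition, reassoc_of% hab])
            refine ⟨g, ?_, fun g' hg' ↦ hu g' ?_⟩
            · apply pullback.hom_ext
              · rw [smul_fst, hg]
              · rw [smul_snd, hab]
            · change g' • (b ≫ _) = _
              rw [← smul_fst, hg'] }
    f := pullback.fst A.π s ≫ A.f
    equivariant := inferInstance }

/-- For a point `x ∈ X(S)`, the object of `[G \ X]` over `S` given by the trivial torsor `G_S` and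
the orbit map `g ↦ g x`. -/
def ofPoint [LocallyOfFiniteType G.hom] (x : S ⟶ X) : QuotientStack G X S :=
  letI : ModObj G (G ⊗ S) := translationAction G S
  have smul_fst {Z : Over (Spec (.of k))} (g : Z ⟶ G) (t : Z ⟶ G ⊗ S) :
      (g • t) ≫ fst G S = g * (t ≫ fst G S) := by
    change (lift g t ≫ lift _ _) ≫ _ = _
    simp [MonObj.comp_mul]
  have smul_snd {Z : Over (Spec (.of k))} (g : Z ⟶ G) (t : Z ⟶ G ⊗ S) :
      (g • t) ≫ snd G S = t ≫ snd G S := by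
    change (lift g t ≫ lift _ _) ≫ _ = _
    simp
  { T := G ⊗ S
    π := snd G S
    torsor :=
      { flat := by
          change Flat (pullback.snd G.hom S.hom)
          infer_instance
        surjective := by
          change Surjective (pullback.snd G.hom S.hom)
          have : Nonempty G.left := ⟨η[G].left (IsLocalRing.closedPoint k)⟩
          have : Surjective G.hom :=
            ⟨Function.surjective_to_subsingleton (α := G.left) (β := Spec (.of k)) _⟩
          infer_instance
        locallyOfFinitePresentation := by
          change LocallyOfFinitePresentation (pullback.snd G.hom S.hom)
          infer_instance
        isPullback := by
          refine (isPullback_iff _).mpr ⟨?_, fun {Z} a b hab ↦ ?_⟩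
          · have h := smul_snd (fst G (G ⊗ S)) (snd G (G ⊗ S))
            simpa only [Hom.smul_def, lift_fst_snd, Category.id_comp] using h
          · refine ⟨(a ≫ fst G S) * (b ≫ fst G S)⁻¹, ?_, fun g hg ↦ ?_⟩
            · apply CartesianMonoidalCategory.hom_ext
              · rw [smul_fst, inv_mul_cancel_right]
              · rw [smul_snd, hab]
            · rw [← hg, smul_fst, mul_inv_cancel_right] }
    f := fst G S • (snd G S ≫ x)
    equivariant := isModHom_of_points _ fun g t ↦ by
      rw [ModObj.comp_smul, ModObj.comp_smul, smul_fst, ← Category.assoc, smul_snd, mul_smul,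
        Category.assoc] }

/-- Right translation by `g` identifies the objects given by the points `g x` and `x`. -/
def ofPointIso [LocallyOfFiniteType G.hom] (g : S ⟶ G) (x : S ⟶ X) :
    ofPoint (G := G) (g • x) ≅ ofPoint (G := G) x where
  hom :=
    { hom := lift (fst G S * (snd G S ≫ g)) (snd G S)
      equivariant := isModHom_translation g
      hom_π := lift_snd _ _
      hom_f := by
        change lift _ _ ≫ (fst G S • (snd G S ≫ x)) = fst G S • (snd G S ≫ (g • x))
        rw [ModObj.comp_smul, ModObj.comp_smul, lift_fst, lift_snd_assoc, mul_smul] }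
  inv :=
    { hom := lift (fst G S * (snd G S ≫ g⁻¹)) (snd G S)
      equivariant := isModHom_translation g⁻¹
      hom_π := lift_snd _ _
      hom_f := by
        change lift _ _ ≫ (fst G S • (snd G S ≫ (g • x))) = fst G S • (snd G S ≫ x)
        rw [ModObj.comp_smul, lift_fst, lift_snd_assoc, ModObj.comp_smul,
          ← mul_smul, mul_assoc, ← MonObj.comp_mul, inv_mul_cancel, MonObj.comp_one, mul_one] }
  hom_inv_id := by
    apply Hom.ext
    change lift (fst G S * (snd G S ≫ g)) (snd G S) ≫
      lift (fst G S * (snd G S ≫ g⁻¹)) (snd G S) = 𝟙 (G ⊗ S)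
    ext1
    · simp only [Category.assoc, lift_fst, lift_snd_assoc, MonObj.comp_mul, mul_assoc,
        Category.id_comp]
      rw [← MonObj.comp_mul, mul_inv_cancel, MonObj.comp_one, mul_one]
    · simp
  inv_hom_id := by
    apply Hom.ext
    change lift (fst G S * (snd G S ≫ g⁻¹)) (snd G S) ≫
      lift (fst G S * (snd G S ≫ g)) (snd G S) = 𝟙 (G ⊗ S)
    ext1
    · simp only [Category.assoc, lift_fst, lift_snd_assoc, MonObj.comp_mul, mul_assoc,
        Category.id_comp]
      rw [← MonObj.comp_mul, inv_mul_cancel, MonObj.comp_one, mul_one]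
    · simp

end QuotientStack

/-! ### Geometric orbits and models -/

variable (k) in
/-- `Spec A` as a `k`-scheme. -/
abbrev specOver (A : Type u) [CommRing A] [Algebra k A] : Over (Spec (.of k)) :=
  Over.mk (Spec.map (CommRingCat.ofHom (algebraMap k A)))

/-- The morphism `Spec B → Spec A` over `k` of a homomorphism of `k`-algebras `A → B`. -/
def specMap {A B : Type u} [CommRing A] [CommRing B] [Algebra k A] [Algebra k B]
    (φ : A →ₐ[k] B) : specOver k B ⟶ specOver k A :=
  Over.homMk (Spec.map (CommRingCat.ofHom φ.toRingHom)) (by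
    change Spec.map _ ≫ Spec.map _ = Spec.map _
    rw [← Spec.map_comp, ← CommRingCat.ofHom_comp, AlgHom.toRingHom_eq_coe, AlgHom.comp_algebraMap])

theorem specMap_id (A : Type u) [CommRing A] [Algebra k A] :
    specMap (AlgHom.id k A) = 𝟙 (specOver k A) := by
  ext1
  exact Spec.map_id _

theorem specMap_comp {A B D : Type u} [CommRing A] [CommRing B] [CommRing D] [Algebra k A]
    [Algebra k B] [Algebra k D] (φ : A →ₐ[k] B) (ψ : B →ₐ[k] D) :
    specMap (ψ.comp φ) = specMap ψ ≫ specMap φ := by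
  ext1
  exact Spec.map_comp (CommRingCat.ofHom φ.toRingHom) (CommRingCat.ofHom ψ.toRingHom)

variable (G X : Over (Spec (.of k))) [GrpObj G] [ModObj G X]
variable (L : Type u) [Field L] [Algebra k L]

/-- The set `G(L) \ X(L)` of orbits of `G(L)` on `X(L)`. -/
def Orbits : Type u :=
  MulAction.orbitRel.Quotient (specOver k L ⟶ G) (specOver k L ⟶ X)

/-- The Galois group acts on `X(L)` by `σ x = x ∘ Spec σ`, and thereby on `G(L) \ X(L)`. -/
instance : MulAction Gal(L/k) (Orbits G X L) where
  smul σ := Quotient.map (fun x ↦ specMap (σ : L →ₐ[k] L) ≫ x) (by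
    rintro _ y ⟨g, rfl⟩
    exact ⟨specMap (σ : L →ₐ[k] L) ≫ g, (ModObj.comp_smul _ _ _).symm⟩)
  one_smul C := by
    induction C using Quotient.inductionOn with
    | h x =>
      refine congrArg (Quotient.mk _) ?_
      change specMap (AlgHom.id k L) ≫ x = x
      rw [specMap_id, Category.id_comp]
  mul_smul σ τ C := by
    induction C using Quotient.inductionOn with
    | h x =>
      refine congrArg (Quotient.mk _) ?_
      change specMap ((σ : L →ₐ[k] L).comp (τ : L →ₐ[k] L)) ≫ x = _
      rw [specMap_comp, Category.assoc]

variable {G X L}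

/-- The isomorphism class `P(C)` in `[G \ X](L)` that corresponds to an orbit `C` of `G(L)` on
`X(L)`: the class of the trivial torsor with the orbit map `g ↦ g x`, for any `x ∈ C`. -/
def P [LocallyOfFiniteType G.hom] (C : Orbits G X L) :
    QuotientStack.IsoClasses G X (specOver k L) :=
  Quotient.lift
    (fun x : specOver k L ⟶ X ↦ Quotient.mk (isIsomorphicSetoid _) (QuotientStack.ofPoint (G := G) x))
    (by
      rintro _ y ⟨g, rfl⟩
      exact Quotient.sound ⟨QuotientStack.ofPointIso g y⟩) C

/-- An isomorphism class in `[G \ X](L)` has a model over the subextension `k'` of `L/k` if it is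
the class of the base change to `L` of an object of `[G \ X](k')`. -/
def HasModel (k' : Type u) [Field k'] [Algebra k k'] [Algebra k' L] [IsScalarTower k k' L]
    (c : QuotientStack.IsoClasses G X (specOver k L)) : Prop :=
  ∃ M : QuotientStack G X (specOver k k'),
    Quotient.mk (isIsomorphicSetoid _) (M.baseChange (specMap (IsScalarTower.toAlgHom k k' L))) = c

end Stack

end QuotStack

end

/-! A model together with an isomorphism to the trivial torsor gives a geometric point `t` of the
torsor lying over `x`. For `σ` in the Galois group of `k'`, the points `σ t` and `t` have the same
image in `Spec k'`, so `σ t = h t` with `h ∈ G(k̄)`, and hence `σ x = h x`. This is the easy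
direction.

Conversely, only the Frobenius `s` of `k'` is needed: `s x = g x` for some `g ∈ G(k̄)`. A model is
obtained by descending the trivial torsor along the twist `(a, t) ↦ (a g(t)⁻¹, F t)`, which commutes
with left translations and preserves the orbit map `a ↦ a x`. Its iterates involve the norms `g_i =
s^{i-1}(g) ⋯ s(g) g`. These all lie in `G(K₀)` for one finite field `K₀`, a finite set, and they
form the orbit of `1` under an injective map; so they are purely periodic and `g_m = 1` whenever `n
∣ m`, for some `n > 0` (`exists_normIter_eq_one`). Then `s^n x = g_n x = x`, so `x` is also defined
over a finite field, although `X` is arbitrary. Over a finite `K` that contains all fields of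
definition and has degree `N` divisible by `n`, the `N`-th iterate of the twist is the identity: it
is a descent datum for the cyclic extension `K / k'`.

Such a datum is effective if `G_K` is covered by stable affine opens (`exists_quotient`): each has
the spectrum of its invariants as quotient, and the quotients glue. To find the cover, take a dense
affine open `U` of `G`. The `y` with `s^i(h) y g_i⁻¹ ∈ U` for all `i` form a finite intersection of
affine opens, which is affine since `G` is separated, and it is stable under the twist. It contains
a given `k̄`-point `a` once `h w ∈ U` for the finitely many `w = s^{-i}(a g_i⁻¹)`, because `U` is
defined over `k`; such an `h` exists since finitely many dense open translates of `U` meet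
(`exists_finite_cover`). Finally the action and the map to `X` descend to the quotient
(`exists_quotientStack_of_descent`), and the image of the unit section is a point over `x` that
trivializes the torsor over `k̄`. -/

namespace QuotStack

/-! ### Linear algebra of cyclic Galois descent -/

section CyclicDescent

open Module

variable {k K : Type*} [Field k] [Field K] [Algebra k K] {N : ℕ}

/-- If the order of `F` is the degree of `K / k`, then the matrix of the conjugates of a basis under
the powers of `F` is invertible. -/
theorem isUnit_conjugateMatrix (F : K →ₐ[k] K) (hF : orderOf F = N) (b : Basis (Fin N) k K) :
    IsUnit (Matrix.of fun i j : Fin N ↦ (F ^ (i : ℕ)) (b j)) := by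
  rw [← Matrix.linearIndependent_rows_iff_isUnit]
  -- Dedekind's independence of characters; the powers below the order of `F` are distinct.
  have h := (linearIndependent_algHom_toLinearMap k K K).comp
    (fun i : Fin N ↦ F ^ (i : ℕ)) (fun i j hij ↦ Fin.ext
      (pow_injOn_Iio_orderOf (by simp [hF]) (by simp [hF]) hij))
  exact h.map' (b.constr K).symm.toLinearMap (LinearEquiv.ker _)

variable {A : Type*} [CommRing A] [Algebra K A]

theorem iterate_smul_of_semilinear {F : K →ₐ[k] K} {φ : A →+* A}
    (hφ : ∀ c a, φ (c • a) = F c • φ a) (n : ℕ) (c : K) (a : A) :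
    φ^[n] (c • a) = (F ^ n) c • φ^[n] a := by
  induction n generalizing c a with
  | zero => simp
  | succ n ih => rw [Function.iterate_succ_apply, hφ, ih, pow_succ, Function.iterate_succ_apply]; rfl

variable [Algebra k A] [IsScalarTower k K A]

/-- Descent for algebras with a cyclic semilinear action: such an algebra is the base change of
its subalgebra of invariants. -/
theorem bijective_lift_invariants [NeZero N] (hd : finrank k K = N) (F : K →ₐ[k] K)
    (hF : orderOf F = N) (φ : A →+* A) (hφ : ∀ c a, φ (c • a) = F c • φ a) (hN : φ^[N] = id)
    (B : Subalgebra k A) (hB : ∀ a, a ∈ B ↔ φ a = a) :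
    Function.Bijective (Algebra.TensorProduct.lift (Algebra.ofId K A) B.val
      (fun _ _ ↦ Commute.all _ _)) := by
  have : FiniteDimensional k K := FiniteDimensional.of_finrank_pos (hd ▸ Nat.pos_of_neZero N)
  let b : Basis (Fin N) k K := finBasisOfFinrankEq k K hd
  obtain ⟨M', hM', hM⟩ := isUnit_iff_exists.mp (isUnit_conjugateMatrix F hF b)
  have hiter (n : ℕ) (x : B) : φ^[n] (x : A) = x :=
    Function.iterate_fixed ((hB _).mp x.2) n
  have hsum (z : TensorProduct k K B) : ∃ y : Fin N → B, z = ∑ i, b i ⊗ₜ[k] y i := by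
    induction z with
    | zero => exact ⟨0, by simp⟩
    | tmul c x =>
      refine ⟨fun i ↦ b.repr c i • x, ?_⟩
      conv_lhs => rw [← b.sum_repr c, TensorProduct.sum_tmul]
      simp [TensorProduct.smul_tmul]
    | add z₁ z₂ h₁ h₂ =>
      obtain ⟨y₁, rfl⟩ := h₁
      obtain ⟨y₂, rfl⟩ := h₂
      exact ⟨y₁ + y₂, by simp [TensorProduct.tmul_add, Finset.sum_add_distrib]⟩
  constructor
  · rw [injective_iff_map_eq_zero]
    intro z hz
    obtain ⟨y, rfl⟩ := hsum z
    have h1 : ∑ i, b i • (y i : A) = 0 := by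
      simpa [Algebra.smul_def, Algebra.ofId_apply] using hz
    -- Applying `φ^j` to the relation conjugates its coefficients and fixes the invariants; the
    -- invertible conjugate matrix then forces all `y i` to vanish.
    have h2 (j : Fin N) : ∑ i, (F ^ (j : ℕ)) (b i) • (y i : A) = 0 := by
      have := congrArg (φ^[(j : ℕ)]) h1
      rw [iterate_map_zero, ← RingHom.coe_pow, map_sum] at this
      rw [← this]
      refine Finset.sum_congr rfl fun i _ ↦ ?_
      rw [RingHom.coe_pow, iterate_smul_of_semilinear hφ, hiter]
    have h3 (l : Fin N) : y l = 0 := by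
      have : ∑ j, M' l j • ∑ i, (F ^ (j : ℕ)) (b i) • (y i : A) = 0 :=
        Finset.sum_eq_zero fun j _ ↦ by rw [h2, smul_zero]
      simp_rw [Finset.smul_sum, smul_smul] at this
      rw [Finset.sum_comm] at this
      simp_rw [← Finset.sum_smul] at this
      have h4 (i : Fin N) : ∑ j, M' l j * (F ^ (j : ℕ)) (b i) = (1 : Matrix _ _ K) l i := by
        rw [← hM, Matrix.mul_apply]; rfl
      simp_rw [h4, Matrix.one_apply] at this
      simpa using this
    simp [h3]
  · intro a
    -- Traces are invariant: `φ` shifts the sum by one, and `φ^N = id` closes the cycle.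
    have hmem (c : K) : ∑ j ∈ Finset.range N, φ^[j] (c • a) ∈ B := by
      rw [hB, map_sum]
      simp_rw [← Function.iterate_succ_apply' φ]
      have h := Finset.sum_range_succ (fun j ↦ φ^[j] (c • a)) N
      rw [Finset.sum_range_succ', hN] at h
      simpa using h
    -- The column `0` of the inverse matrix isolates the term `φ^0 a = a` from the traces of the `b
    -- i • a`.
    refine ⟨∑ i, M' i 0 ⊗ₜ ⟨_, hmem (b i)⟩, ?_⟩
    simp only [map_sum, Algebra.TensorProduct.lift_tmul, Algebra.ofId_apply, Subalgebra.coe_val,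
      ← Algebra.smul_def, Finset.smul_sum, iterate_smul_of_semilinear hφ, smul_smul]
    rw [Finset.sum_comm]
    simp_rw [← Finset.sum_smul]
    rw [Finset.sum_range]
    have h4 (j : Fin N) : ∑ i, M' i 0 * (F ^ (j : ℕ)) (b i) = (1 : Matrix (Fin N) (Fin N) K) j 0 := by
      rw [← hM', Matrix.mul_apply]
      exact Finset.sum_congr rfl fun i _ ↦ mul_comm _ _
    simp_rw [h4, Matrix.one_apply]
    simp

/-- The `k`-algebra `K ⊗ K` splits as a product of copies of `K` indexed by the powers of `F`. -/
theorem bijective_tensor_pi [NeZero N] (hd : finrank k K = N) (F : K →ₐ[k] K)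
    (hF : orderOf F = N) :
    Function.Bijective (AlgHom.pi (R := k) (A := fun _ : Fin N ↦ K) fun i ↦
      Algebra.TensorProduct.lift (AlgHom.id k K) (F ^ (i : ℕ)) (fun _ _ ↦ Commute.all _ _)) := by
  have : FiniteDimensional k K := FiniteDimensional.of_finrank_pos (hd ▸ Nat.pos_of_neZero N)
  let b : Basis (Fin N) k K := finBasisOfFinrankEq k K hd
  obtain ⟨M', hM', hM⟩ := isUnit_iff_exists.mp (isUnit_conjugateMatrix F hF b)
  set f := AlgHom.pi (R := k) (A := fun _ : Fin N ↦ K) fun i ↦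
      Algebra.TensorProduct.lift (AlgHom.id k K) (F ^ (i : ℕ)) (fun _ _ ↦ Commute.all _ _)
  have hs : Function.Surjective f := by
    intro v
    refine ⟨∑ i, (∑ l, M' i l * v l) ⊗ₜ b i, ?_⟩
    ext j
    simp only [f, map_sum, AlgHom.pi_apply, Algebra.TensorProduct.lift_tmul,
      AlgHom.coe_id, id, Finset.sum_mul]
    rw [Finset.sum_comm]
    have h4 (l : Fin N) : ∑ i, (F ^ (j : ℕ)) (b i) * M' i l = (1 : Matrix _ _ K) j l := by
      rw [← hM', Matrix.mul_apply]; rfl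
    have : ∀ l, ∑ i, M' i l * v l * (F ^ (j : ℕ)) (b i) = (1 : Matrix _ _ K) j l * v l := by
      intro l
      rw [← h4, Finset.sum_mul]
      exact Finset.sum_congr rfl fun i _ ↦ by ring
    simp_rw [this, Matrix.one_apply]
    simp
  refine ⟨?_, hs⟩
  -- Both sides have dimension `N²`, so surjectivity is enough.
  have hd : finrank k (TensorProduct k K K) = finrank k (Fin N → K) := by
    rw [finrank_tensorProduct, finrank_pi_fintype]; simp [hd]
  exact (LinearMap.injective_iff_surjective_of_finrank_eq_finrank (f := f.toLinearMap) hd).mpr hs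

end CyclicDescent

end QuotStack

namespace QuotStack

/-! ### Descent of morphisms along a cyclic extension -/

section CyclicDescentOfMorphisms

open Module

variable {k K : Type u} [Field k] [Field K] [Algebra k K] {N : ℕ} [NeZero N]

theorem comp_algebraMap_eq_of_semilinear {R : Type*} [CommRing R] (F : K →ₐ[k] K) (i : K →+* R)
    (φ : R →+* R) (hφ : φ.comp i = i.comp F) (c : k) :
    i (algebraMap k K c) ∈ φ.eqLocus (RingHom.id R) := by
  have := RingHom.congr_fun hφ (algebraMap k K c)
  simpa [RingHom.eqLocus] using this

/-- The structure morphism of the ring of invariants of a semilinear endomorphism. -/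
def toInvariants {R : Type*} [CommRing R] (F : K →ₐ[k] K) (i : K →+* R) (φ : R →+* R)
    (hφ : φ.comp i = i.comp F) : k →+* φ.eqLocus (RingHom.id R) :=
  (i.comp (algebraMap k K)).codRestrict _ (comp_algebraMap_eq_of_semilinear F i φ hφ)

/-- The geometric form of `bijective_lift_invariants`: an affine scheme with a semilinear action of
order dividing `N` is the base change of the spectrum of its invariants. -/
theorem isPullback_Spec_invariants (hd : finrank k K = N) (F : K →ₐ[k] K) (hF : orderOf F = N)
    {R : Type u} [CommRing R] (i : K →+* R) (φ : R →+* R)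
    (hφ : φ.comp i = i.comp F) (hN : φ^[N] = id) :
    IsPullback (Spec.map (CommRingCat.ofHom (φ.eqLocus (RingHom.id R)).subtype))
      (Spec.map (CommRingCat.ofHom i)) (Spec.map (CommRingCat.ofHom (toInvariants F i φ hφ)))
      (Spec.map (CommRingCat.ofHom (algebraMap k K))) := by
  let := i.toAlgebra
  let := (i.comp (algebraMap k K)).toAlgebra
  have : IsScalarTower k K R := .of_algebraMap_eq fun _ ↦ rfl
  let B : Subalgebra k R :=
    { (φ.eqLocus (RingHom.id R)) with
      algebraMap_mem' := comp_algebraMap_eq_of_semilinear F i φ hφ }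
  have hbij := bijective_lift_invariants (A := R) hd F hF φ
    (fun c a ↦ by
      rw [Algebra.smul_def, Algebra.smul_def, map_mul]
      exact congrArg (· * _) (RingHom.congr_fun hφ c)) hN B (fun a ↦ Iff.rfl)
  have : Algebra.IsPushout k K B R := by
    rw [Algebra.isPushout_iff]
    exact IsBaseChange.of_equiv (AlgEquiv.ofBijective _ hbij).toLinearEquiv fun b ↦ by simp
  have h := CommRingCat.isPushout_of_isPushout k K B R
  exact isPullback_SpecMap_of_isPushout _ _ _ _ h.flip

/-- The copies of `Spec K` in `Spec K ×_k Spec K` given by the graphs of the powers of `F`. -/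
theorem exists_openCover_pullback (hd : finrank k K = N) (F : K →ₐ[k] K) (hF : orderOf F = N) :
    ∃ 𝒰 : Scheme.OpenCover.{u} (pullback (Spec.map (CommRingCat.ofHom (algebraMap k K)))
      (Spec.map (CommRingCat.ofHom (algebraMap k K)))), ∀ j : 𝒰.I₀, ∃ n : ℕ,
        𝒰.f j ≫ pullback.snd _ _ =
          𝒰.f j ≫ pullback.fst _ _ ≫ Spec.map (CommRingCat.ofHom (F ^ n).toRingHom) := by
  let f := AlgHom.pi (R := k) (A := fun _ : ULift.{u} (Fin N) ↦ K) fun i ↦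
      Algebra.TensorProduct.lift (AlgHom.id k K) (F ^ (i.down : ℕ)) (fun _ _ ↦ Commute.all _ _)
  have hf : Function.Bijective f :=
    (Equiv.ulift.{u}.arrowCongr (Equiv.refl K)).symm.bijective.comp (bijective_tensor_pi hd F hF)
  have : IsIso (CommRingCat.ofHom f.toRingHom) :=
    (ConcreteCategory.isIso_iff_bijective _).mpr hf
  let R : ULift.{u} (Fin N) → CommRingCat := fun _ ↦ .of K
  let α : (∐ fun i ↦ Spec (R i)) ⟶ _ :=
    sigmaSpec R ≫ Spec.map (CommRingCat.ofHom f.toRingHom) ≫ (pullbackSpecIso k K K).inv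
  have : IsIso α := IsIso.comp_isIso' inferInstance (IsIso.comp_isIso' inferInstance inferInstance)
  have hα (j : ULift.{u} (Fin N)) : Sigma.ι (fun i ↦ Spec (R i)) j ≫ α =
      Spec.map (CommRingCat.ofHom ((Pi.evalRingHom (fun _ ↦ K) j).comp f.toRingHom)) ≫
        (pullbackSpecIso k K K).inv := by
    simp only [α]
    rw [ι_sigmaSpec_assoc, ← Spec.map_comp_assoc]
    rfl
  have key (j : ULift.{u} (Fin N)) : (Sigma.ι (fun i ↦ Spec (R i)) j ≫ α) ≫ pullback.snd _ _ =
      (Sigma.ι (fun i ↦ Spec (R i)) j ≫ α) ≫ pullback.fst _ _ ≫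
        Spec.map (CommRingCat.ofHom (F ^ (j.down : ℕ)).toRingHom) := by
    rw [hα, Category.assoc, Category.assoc, pullbackSpecIso_inv_snd, pullbackSpecIso_inv_fst_assoc,
      ← Spec.map_comp, ← Spec.map_comp, ← Spec.map_comp]
    congr 1
    ext c
    change f (1 ⊗ₜ c) j = f ((F ^ (j.down : ℕ)) c ⊗ₜ 1) j
    simp [f]
  exact ⟨(sigmaOpenCover fun i ↦ Spec (R i)).pushforwardIso α, fun j ↦ ⟨_, key j⟩⟩

variable {Z Z' W : Scheme.{u}} {q : Z' ⟶ Z} {r : Z' ⟶ Spec (.of K)} {z : Z ⟶ Spec (.of k)}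

/-- `Spec K → Spec k` is an fpqc cover and `q` is a base change of it. This supplies the
epimorphisms and the descent of properties used below. -/
theorem flat_of_isPullback
    (h : IsPullback q r z (Spec.map (CommRingCat.ofHom (algebraMap k K)))) :
    Flat q ∧ Surjective q ∧ QuasiCompact q := by
  have : Surjective (Spec.map (CommRingCat.ofHom (algebraMap k K))) :=
    ⟨Function.surjective_to_subsingleton (α := Spec (.of K)) (β := Spec (.of k)) _⟩
  exact ⟨MorphismProperty.of_isPullback (P := @Flat) h.flip inferInstance,
    MorphismProperty.of_isPullback (P := @Surjective) h.flip inferInstance,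
    MorphismProperty.of_isPullback (P := @QuasiCompact) h.flip inferInstance⟩

/-- A morphism on a base change from `k` to `K` descends if it is invariant under a generator of the
Galois group. -/
theorem exists_desc_of_invariant (hd : finrank k K = N) (F : K →ₐ[k] K) (hF : orderOf F = N)
    (h : IsPullback q r z (Spec.map (CommRingCat.ofHom (algebraMap k K))))
    (φ : Z' ⟶ Z') (hq : φ ≫ q = q) (hr : φ ≫ r = r ≫ Spec.map (CommRingCat.ofHom F.toRingHom))
    (f : Z' ⟶ W) (hf : φ ≫ f = f) : ∃ f' : Z ⟶ W, q ≫ f' = f := by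
  obtain ⟨_, _, _⟩ := flat_of_isPullback h
  have hpow (n : ℕ) : ∃ ψ : Z' ⟶ Z', ψ ≫ q = q ∧ ψ ≫ f = f ∧
      ψ ≫ r = r ≫ Spec.map (CommRingCat.ofHom (F ^ n).toRingHom) := by
    induction n with
    | zero =>
      refine ⟨𝟙 _, by simp, by simp, ?_⟩
      rw [Category.id_comp]
      exact (Category.comp_id r).symm.trans (congrArg (r ≫ ·) (Spec.map_id _).symm)
    | succ n ih =>
      obtain ⟨ψ, h₁, h₂, h₃⟩ := ih
      refine ⟨ψ ≫ φ, by simp [hq, h₁], by simp [hf, h₂], ?_⟩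
      rw [Category.assoc, hr, reassoc_of% h₃, ← Spec.map_comp, pow_succ]
      rfl
  -- An fpqc cover is a regular epimorphism, so the two pullbacks of `f` to the kernel pair must
  -- agree. The kernel pair is covered by the graphs of the powers of `φ`, which preserve `f`.
  refine IsRegularEpi.exists_of_isKernelPair q (IsPullback.of_hasPullback q q) f ?_
  obtain ⟨𝒰, h𝒰⟩ := exists_openCover_pullback hd F hF
  let c : pullback q q ⟶ pullback (Spec.map (CommRingCat.ofHom (algebraMap k K)))
      (Spec.map (CommRingCat.ofHom (algebraMap k K))) :=
    pullback.map _ _ _ _ r r z h.w h.w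
  refine Scheme.Cover.hom_ext (𝒰.pullback₁ c) _ _ fun j ↦ ?_
  obtain ⟨n, hn⟩ := h𝒰 j
  obtain ⟨ψ, h₁, h₂, h₃⟩ := hpow n
  change pullback.fst c (𝒰.f j) ≫ _ = pullback.fst c (𝒰.f j) ≫ _
  have : pullback.fst c (𝒰.f j) ≫ pullback.snd q q =
      pullback.fst c (𝒰.f j) ≫ pullback.fst q q ≫ ψ := by
    apply h.hom_ext
    · simp [h₁, pullback.condition]
    · have e₁ : pullback.fst q q ≫ r = c ≫ pullback.fst _ _ := by simp only [c, pullback.lift_fst]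
      have e₂ : pullback.snd q q ≫ r = c ≫ pullback.snd _ _ := by simp only [c, pullback.lift_snd]
      simp only [Category.assoc, h₃, e₂, reassoc_of% e₁, pullback.condition_assoc, hn]
  rw [reassoc_of% this, h₂]

end CyclicDescentOfMorphisms

end QuotStack

namespace QuotStack

/-! ### Gluing quotients of charts -/

section Gluing

variable {J : Type u} [Category.{u} J] {A B : J ⥤ Scheme.{u}} (q : A ⟶ B)
  (hq : ∀ {i j : J} (f : i ⟶ j), IsPullback (A.map f) (q.app i) (q.app j) (B.map f))
  (hs : ∀ i, Surjective (q.app i)) {Y : Scheme.{u}} (c : ∀ i, A.obj i ⟶ Y)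
  (hw : ∀ {i j : J} (f : i ⟶ j), A.map f ≫ c j = c i)
  (hdir : ∀ {i j : J} (x : A.obj i) (y : A.obj j), c i x = c j y →
    ∃ (l : J) (fi : l ⟶ i) (fj : l ⟶ j) (z : A.obj l), A.map fi z = x ∧ A.map fj z = y)

theorem exists_of_isPullback {X Y Z W : Scheme.{u}} {f : W ⟶ X} {g : W ⟶ Y} {h : X ⟶ Z} {i : Y ⟶ Z}
    (H : IsPullback f g h i) (x : X) (y : Y) (hxy : h x = i y) : ∃ w : W, f w = x ∧ g w = y := by
  obtain ⟨w, hw₁, hw₂⟩ := Scheme.Pullback.exists_preimage_pullback x y hxy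
  refine ⟨H.isoPullback.inv w, ?_, ?_⟩
  · rw [← Scheme.Hom.comp_apply, H.isoPullback_inv_fst, hw₁]
  · rw [← Scheme.Hom.comp_apply, H.isoPullback_inv_snd, hw₂]

include hq hs hw hdir in
/-- A diagram is locally directed if it is covered by the charts of a scheme that form a locally
directed diagram. -/
theorem isLocallyDirected_of_charts : (B ⋙ Scheme.forget).IsLocallyDirected where
  cond {i j k} fi fj xi xj h := by
    replace h : B.map fi xi = B.map fj xj := h
    obtain ⟨y, hy⟩ := (hs k).surj (B.map fi xi)
    obtain ⟨a, ha, ha'⟩ := exists_of_isPullback (hq fi) y xi hy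
    obtain ⟨b, hb, hb'⟩ := exists_of_isPullback (hq fj) y xj (hy.trans h)
    obtain ⟨l, gi, gj, z, hz, hz'⟩ := hdir a b (by
      rw [← hw fi, ← hw fj, Scheme.Hom.comp_apply, Scheme.Hom.comp_apply, ha, hb])
    refine ⟨l, gi, gj, q.app l z, ?_, ?_⟩
    · change B.map gi (q.app l z) = xi
      rw [← Scheme.Hom.comp_apply, ← q.naturality, Scheme.Hom.comp_apply, hz, ha']
    · change B.map gj (q.app l z) = xj
      rw [← Scheme.Hom.comp_apply, ← q.naturality, Scheme.Hom.comp_apply, hz', hb']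

variable [Quiver.IsThin J] [∀ {i j} (f : i ⟶ j), IsOpenImmersion (B.map f)]
  [(B ⋙ Scheme.forget).IsLocallyDirected] [∀ i, IsOpenImmersion (c i)]

include hq hw hdir in
/-- Quotients of the charts of a scheme `Y` glue to a quotient of `Y`. -/
theorem exists_desc_of_charts (hcov : ∀ y : Y, ∃ (i : J) (x : A.obj i), c i x = y) :
    ∃ p : Y ⟶ colimit B, ∀ i, IsPullback (c i) (q.app i) p (colimit.ι B i) := by
  have hA {i j : J} (f : i ⟶ j) : IsOpenImmersion (A.map f) := by
    have : IsOpenImmersion (A.map f ≫ c j) := by rw [hw]; infer_instance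
    exact IsOpenImmersion.of_comp _ (c j)
  let 𝒰 : Y.OpenCover :=
    { I₀ := J, X := A.obj, f := c
      mem₀ := by
        rw [Scheme.presieve₀_mem_precoverage_iff]
        exact ⟨hcov, inferInstance⟩ }
  let p : Y ⟶ colimit B := 𝒰.glueMorphisms (fun i ↦ q.app i ≫ colimit.ι B i) fun i j ↦ by
    change pullback.fst (c i) (c j) ≫ _ = pullback.snd (c i) (c j) ≫ _
    -- Near each point of the overlap there is a smaller chart of the diagram, where the two maps
    -- agree by naturality.
    refine Scheme.hom_ext_of_forall _ _ fun t ↦ ?_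
    obtain ⟨l, fi, fj, z, hz, hz'⟩ := hdir (pullback.fst (c i) (c j) t) (pullback.snd (c i) (c j) t)
      (by rw [← Scheme.Hom.comp_apply, pullback.condition, Scheme.Hom.comp_apply])
    let α : A.obj l ⟶ pullback (c i) (c j) := pullback.lift (A.map fi) (A.map fj) (by rw [hw, hw])
    have : IsOpenImmersion α := by
      have : IsOpenImmersion (α ≫ pullback.fst _ _) := by
        rw [pullback.lift_fst]; exact hA fi
      exact .of_comp _ (pullback.fst _ _)
    refine ⟨α.opensRange, ⟨z, ?_⟩, ?_⟩
    · apply (pullback.fst (c i) (c j)).isOpenEmbedding.injective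
      rw [← Scheme.Hom.comp_apply, pullback.lift_fst, hz]
    · rw [← cancel_epi α.isoOpensRange.hom, Scheme.Hom.isoOpensRange_hom_ι_assoc,
        Scheme.Hom.isoOpensRange_hom_ι_assoc, pullback.lift_fst_assoc, pullback.lift_snd_assoc,
        q.naturality_assoc, q.naturality_assoc, colimit.w, colimit.w]
  have hp (i : J) : c i ≫ p = q.app i ≫ colimit.ι B i := 𝒰.ι_glueMorphisms _ _ i
  -- Since `c i` and `colimit.ι B i` are open immersions, the square is cartesian once the range of
  -- `c i` is the full preimage of that of `colimit.ι B i`.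
  refine ⟨p, fun i ↦ (IsOpenImmersion.isPullback _ _ _ _ (hp i) ?_).flip⟩
  ext y
  constructor
  · rintro ⟨b, hb⟩
    obtain ⟨j, a, rfl⟩ := hcov y
    rw [← Scheme.Hom.comp_apply, hp, Scheme.Hom.comp_apply] at hb
    obtain ⟨l, fi, fj, x, -, hx⟩ := (Scheme.IsLocallyDirected.ι_eq_ι_iff B).mp hb
    obtain ⟨w, hw', -⟩ := exists_of_isPullback (hq fj) a x hx.symm
    refine ⟨A.map fi w, ?_⟩
    rw [← Scheme.Hom.comp_apply, hw, ← hw fj, Scheme.Hom.comp_apply, hw']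
  · rintro ⟨a, rfl⟩
    refine ⟨q.app i a, ?_⟩
    rw [← Scheme.Hom.comp_apply, ← Scheme.Hom.comp_apply, hp]

/-- Whether a square is cartesian may be checked on an open cover of the base. -/
theorem isPullback_of_charts {T S E : Scheme.{u}} {p : Y ⟶ T} {r : Y ⟶ E} {π : T ⟶ S} {e : E ⟶ S}
    (h : p ≫ π = r ≫ e) {I : Type u} {X U : I → Scheme.{u}} (c : ∀ i, X i ⟶ Y) (b : ∀ i, U i ⟶ T)
    [∀ i, IsOpenImmersion (b i)] (hb : ∀ t : T, ∃ (i : I) (x : U i), b i x = t)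
    (q : ∀ i, X i ⟶ U i) (h₁ : ∀ i, IsPullback (c i) (q i) p (b i))
    (h₂ : ∀ i, IsPullback (q i) (c i ≫ r) (b i ≫ π) e) : IsPullback p r π e := by
  let ℓ : Y ⟶ pullback π e := pullback.lift p r h
  have hℓ₁ : ℓ ≫ pullback.fst π e = p := pullback.lift_fst _ _ _
  have hℓ₂ : ℓ ≫ pullback.snd π e = r := pullback.lift_snd _ _ _
  have hd (i : I) : IsPullback (c i ≫ ℓ) (q i) (pullback.fst π e) (b i) := by
    refine (IsPullback.of_bot ?_ ?_ (IsPullback.of_hasPullback π e)).flip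
    · simpa [hℓ₂] using h₂ i
    · simpa [hℓ₁] using (h₁ i).w.symm
  let 𝒰 : (pullback π e).OpenCover :=
    { I₀ := I, X := X, f := fun i ↦ c i ≫ ℓ
      mem₀ := by
        rw [Scheme.presieve₀_mem_precoverage_iff]
        refine ⟨fun t ↦ ?_, fun i ↦ MorphismProperty.of_isPullback (P := @IsOpenImmersion) (hd i).flip inferInstance⟩
        obtain ⟨i, x, hx⟩ := hb (pullback.fst π e t)
        obtain ⟨w, hw, -⟩ := exists_of_isPullback (hd i) t x hx.symm
        exact ⟨i, w, hw⟩ }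
  -- Being an isomorphism is local on the target, and over each chart the comparison map becomes an
  -- identity.
  have : IsIso ℓ := by
    refine (MorphismProperty.isomorphisms Scheme).of_zeroHypercover_target (K := Scheme.zariskiPrecoverage) 𝒰 fun i ↦ ?_
    have hi : IsPullback (c i) (𝟙 _) ℓ (c i ≫ ℓ) := by
      refine IsPullback.of_bot ?_ (Category.id_comp _).symm (hd i)
      simpa [hℓ₁] using h₁ i
    change IsIso (pullback.snd ℓ (c i ≫ ℓ))
    rw [← hi.isoPullback_inv_snd]
    infer_instance
  exact IsPullback.of_iso_pullback ⟨h⟩ (asIso ℓ) hℓ₁ hℓ₂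

end Gluing

end QuotStack

noncomputable section

namespace QuotStack

/-! ### Effectivity of descent with stable affine opens -/

section Quotient

open Module

/-- The iterates of an endomorphism. -/
def iter {C : Type*} [Category* C] {X : C} (f : X ⟶ X) : ℕ → (X ⟶ X)
  | 0 => 𝟙 X
  | n + 1 => f ≫ iter f n

variable {Y : Scheme.{u}} (φ : Y ⟶ Y)

/-- The affine open subschemes that are stable under an endomorphism. -/
abbrev StableAffineOpens : Type u := {V : Y.Opens // IsAffineOpen V ∧ φ ⁻¹ᵁ V = V}

namespace StableAffineOpens

variable {φ} (V W : StableAffineOpens φ)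

/-- The endomorphism of the ring of functions on a stable affine open. -/
def ringEnd : Γ(Y, V.1) →+* Γ(Y, V.1) := (φ.appLE V.1 V.1 V.2.2.ge).hom

/-- The invariant functions on a stable affine open. -/
abbrev invariants : Subring Γ(Y, V.1) := V.ringEnd.eqLocus (RingHom.id _)

variable (φ) in
/-- The diagram of stable affine opens. -/
abbrev spectra : StableAffineOpens φ ⥤ Scheme.{u} where
  obj V := Spec Γ(Y, V.1)
  map f := Spec.map (Y.presheaf.map (homOfLE f.le).op)
  map_id V := by
    change Spec.map (Y.presheaf.map (𝟙 _)) = _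
    rw [CategoryTheory.Functor.map_id, Spec.map_id]
  map_comp f g := by
    rw [← Spec.map_comp, ← Functor.map_comp]
    rfl

theorem map_mem_invariants {V W : StableAffineOpens φ} (h : V ≤ W) (a : W.invariants) :
    Y.presheaf.map (homOfLE h).op a.1 ∈ V.invariants := by
  have h₁ : φ.appLE W.1 W.1 W.2.2.ge ≫ Y.presheaf.map (homOfLE h).op =
      Y.presheaf.map (homOfLE h).op ≫ φ.appLE V.1 V.1 V.2.2.ge := by
    rw [Scheme.Hom.appLE_map, Scheme.Hom.map_appLE]
  have h₂ := congr($h₁ a.1)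
  have h₃ : φ.appLE W.1 W.1 W.2.2.ge a.1 = a.1 := a.2
  change φ.appLE V.1 V.1 V.2.2.ge (Y.presheaf.map (homOfLE h).op a.1) = _
  rw [ConcreteCategory.comp_apply, ConcreteCategory.comp_apply, h₃] at h₂
  exact h₂.symm

/-- Restriction of invariant functions. -/
def restrictInvariants {V W : StableAffineOpens φ} (h : V ≤ W) : W.invariants →+* V.invariants :=
  ((Y.presheaf.map (homOfLE h).op).hom.comp W.invariants.subtype).codRestrict _
    (map_mem_invariants h)

variable (φ) in
/-- The diagram of the spectra of the rings of invariants. -/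
abbrev quotients : StableAffineOpens φ ⥤ Scheme.{u} where
  obj V := Spec (.of V.invariants)
  map f := Spec.map (CommRingCat.ofHom (restrictInvariants f.le))
  map_id V := by
    have : restrictInvariants (le_refl V) = RingHom.id _ := by
      ext a
      change Y.presheaf.map (𝟙 _) a.1 = a.1
      simp
    change Spec.map (CommRingCat.ofHom (restrictInvariants (le_refl V))) = _
    rw [this]
    exact Spec.map_id _
  map_comp {U V W} f g := by
    rw [← Spec.map_comp, ← CommRingCat.ofHom_comp]
    congr 2
    ext a
    change Y.presheaf.map _ a.1 = Y.presheaf.map _ (Y.presheaf.map _ a.1)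
    rw [← ConcreteCategory.comp_apply, ← Functor.map_comp]
    rfl

variable (φ) in
/-- The quotient maps of the stable affine opens. -/
def quotientMap : spectra φ ⟶ quotients φ where
  app V := Spec.map (CommRingCat.ofHom V.invariants.subtype)
  naturality V W f := by
    rw [← Spec.map_comp, ← Spec.map_comp]
    rfl

/-- The inclusion of a stable affine open. -/
def chart : (spectra φ).obj V ⟶ Y := V.2.1.fromSpec

instance : IsOpenImmersion V.chart := inferInstanceAs (IsOpenImmersion V.2.1.fromSpec)

theorem opensRange_chart : V.chart.opensRange = V.1 := V.2.1.opensRange_fromSpec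

theorem map_chart {V W : StableAffineOpens φ} (f : V ⟶ W) : (spectra φ).map f ≫ W.chart = V.chart :=
  W.2.1.map_fromSpec V.2.1 _

/-- The endomorphism of a stable affine open. -/
def specEnd : (spectra φ).obj V ⟶ (spectra φ).obj V := Spec.map (CommRingCat.ofHom V.ringEnd)

theorem chart_comp : V.chart ≫ φ = V.specEnd ≫ V.chart :=
  (V.2.1.SpecMap_appLE_fromSpec φ V.2.1 V.2.2.ge).symm

theorem specEnd_comp_quotientMap :
    V.specEnd ≫ (quotientMap φ).app V = (quotientMap φ).app V := by
  change Spec.map _ ≫ Spec.map _ = Spec.map _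
  rw [← Spec.map_comp]
  congr 1
  ext a
  exact a.2

variable {k K : Type u} [Field k] [Field K] [Algebra k K] {N : ℕ} [NeZero N]
  (F : K →ₐ[k] K) {r : Y ⟶ Spec (.of K)}
  (hr : φ ≫ r = r ≫ Spec.map (CommRingCat.ofHom F.toRingHom))

variable (r) in
/-- The structure map of the ring of functions on a stable affine open. -/
def scalars : K →+* Γ(Y, V.1) := (Spec.preimage (V.chart ≫ r)).hom

theorem SpecMap_scalars : Spec.map (CommRingCat.ofHom (V.scalars r)) = V.chart ≫ r :=
  Spec.map_preimage _

include hr in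
theorem ringEnd_comp_scalars :
    V.ringEnd.comp (V.scalars r) = (V.scalars r).comp (F : K →+* K) := by
  have : CommRingCat.ofHom (V.ringEnd.comp (V.scalars r)) =
      CommRingCat.ofHom ((V.scalars r).comp (F : K →+* K)) := by
    apply Spec.map_injective
    rw [CommRingCat.ofHom_comp, CommRingCat.ofHom_comp, Spec.map_comp, Spec.map_comp,
      SpecMap_scalars]
    change V.specEnd ≫ V.chart ≫ r = _
    rw [← Category.assoc, ← chart_comp, Category.assoc, hr, Category.assoc]
    rfl
  exact congrArg CommRingCat.Hom.hom this

theorem appLE_apply_of_eq_id {Y : Scheme.{u}} {f : Y ⟶ Y} (hf : f = 𝟙 Y) (V : Y.Opens)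
    (h : V ≤ f ⁻¹ᵁ V) (a : Γ(Y, V)) : f.appLE V V h a = a := by
  subst hf
  have : Scheme.Hom.appLE (𝟙 Y) V V h = 𝟙 _ :=
    (Category.id_comp _).trans (Y.presheaf.map_id _)
  rw [this]
  rfl

theorem ringEnd_iterate (n : ℕ) : ∃ h, ∀ a,
    V.ringEnd^[n] a = (iter φ n).appLE V.1 V.1 h a := by
  induction n with
  | zero =>
    exact ⟨le_rfl, fun a ↦ (appLE_apply_of_eq_id rfl V.1 le_rfl a).symm⟩
  | succ n ih =>
    obtain ⟨h, ih⟩ := ih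
    refine ⟨V.2.2.ge.trans (φ.preimage_mono h), fun a ↦ ?_⟩
    rw [Function.iterate_succ_apply', ih]
    change (φ.appLE V.1 V.1 V.2.2.ge) ((iter φ n).appLE V.1 V.1 h a) = _
    rw [← ConcreteCategory.comp_apply, Scheme.Hom.appLE_comp_appLE]
    rfl

/-- The structure morphism of the quotient of a stable affine open. -/
def structureMap : (quotients φ).obj V ⟶ Spec (.of k) :=
  Spec.map (CommRingCat.ofHom (toInvariants F (V.scalars r) V.ringEnd
    (V.ringEnd_comp_scalars F hr)))

theorem map_structureMap {V W : StableAffineOpens φ} (f : V ⟶ W) :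
    (quotients φ).map f ≫ W.structureMap F hr = V.structureMap F hr := by
  rw [structureMap, structureMap, ← Spec.map_comp]
  congr 1
  ext c
  have h : CommRingCat.ofHom (W.scalars r) ≫ Y.presheaf.map (homOfLE f.le).op =
      CommRingCat.ofHom (V.scalars r) := by
    apply Spec.map_injective
    rw [Spec.map_comp, SpecMap_scalars, SpecMap_scalars, ← map_chart f, Category.assoc]
  exact congr($h (algebraMap k K c))

variable (hd : finrank k K = N) (hF : orderOf F = N) (hN : iter φ N = 𝟙 Y)

-- The affine case of effectivity: `iter φ N = 𝟙 Y` makes the `N`-th iterate of `V.ringEnd` trivial,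
-- so descent for algebras applies to the functions on `V`.
include hd hF hN in
theorem isPullback_structureMap : IsPullback ((quotientMap φ).app V) (V.chart ≫ r)
    (V.structureMap F hr) (Spec.map (CommRingCat.ofHom (algebraMap k K))) := by
  rw [← SpecMap_scalars]
  refine isPullback_Spec_invariants hd F hF _ _ _ ?_
  obtain ⟨h, hn⟩ := V.ringEnd_iterate N
  funext a
  rw [hn]
  exact appLE_apply_of_eq_id hN _ _ _

end StableAffineOpens

open StableAffineOpens

variable {k K : Type u} [Field k] [Field K] [Algebra k K] {N : ℕ} [NeZero N]

/-- A scheme over `K` with a semilinear automorphism that generates a descent datum to `k` descends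
to `k` if it is covered by stable affine open subschemes. -/
theorem exists_quotient (hd : finrank k K = N) (F : K →ₐ[k] K) (hF : orderOf F = N)
    (r : Y ⟶ Spec (.of K)) (hr : φ ≫ r = r ≫ Spec.map (CommRingCat.ofHom F.toRingHom))
    (hN : iter φ N = 𝟙 Y)
    (hinf : ∀ U V : Y.Opens, IsAffineOpen U → IsAffineOpen V → IsAffineOpen (U ⊓ V))
    (hcov : ∀ y : Y, ∃ V : StableAffineOpens φ, y ∈ V.1) :
    ∃ (T : Scheme.{u}) (π : T ⟶ Spec (.of k)) (p : Y ⟶ T), φ ≫ p = p ∧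
      IsPullback p r π (Spec.map (CommRingCat.ofHom (algebraMap k K))) := by
  have hpb (V : StableAffineOpens φ) := V.isPullback_structureMap F hr hd hF hN
  have hq {V W : StableAffineOpens φ} (f : V ⟶ W) : IsPullback ((spectra φ).map f)
      ((quotientMap φ).app V) ((quotientMap φ).app W) ((quotients φ).map f) := by
    have hpbV := hpb V
    refine (IsPullback.of_bot ?_ ((quotientMap φ).naturality f).symm (hpb W)).flip
    rw [map_structureMap]
    rw [← map_chart f, Category.assoc] at hpbV
    exact hpbV
  have hflat (V : StableAffineOpens φ) := flat_of_isPullback (hpb V)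
  have hs (V : StableAffineOpens φ) : Surjective ((quotientMap φ).app V) := (hflat V).2.1
  let c (V : StableAffineOpens φ) : (spectra φ).obj V ⟶ Y := V.chart
  have hw {V W : StableAffineOpens φ} (f : V ⟶ W) : (spectra φ).map f ≫ c W = c V := map_chart f
  have hopen {V W : StableAffineOpens φ} (f : V ⟶ W) : IsOpenImmersion ((spectra φ).map f) := by
    have : IsOpenImmersion ((spectra φ).map f ≫ c W) := by rw [hw]; infer_instance
    exact IsOpenImmersion.of_comp _ (c W)
  -- Being an open immersion descends along the fpqc quotient map of `W`.
  have hopen' {V W : StableAffineOpens φ} (f : V ⟶ W) : IsOpenImmersion ((quotients φ).map f) :=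
    MorphismProperty.of_isPullback_of_descendsAlong (P := @IsOpenImmersion)
      (Q := @Surjective ⊓ @Flat ⊓ @QuasiCompact) (hq f)
      ⟨⟨(hflat W).2.1, (hflat W).1⟩, (hflat W).2.2⟩ (hopen f)
  have hdir {V W : StableAffineOpens φ} (x : (spectra φ).obj V) (y : (spectra φ).obj W)
      (hxy : c V x = c W y) : ∃ (L : StableAffineOpens φ) (f : L ⟶ V) (g : L ⟶ W)
        (z : (spectra φ).obj L), (spectra φ).map f z = x ∧ (spectra φ).map g z = y := by
    -- Any common point of two stable affine opens lies in their intersection, which is again stable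
    -- and, by `hinf`, affine.
    let L : StableAffineOpens φ := ⟨V.1 ⊓ W.1, hinf _ _ V.2.1 W.2.1, by
      rw [Scheme.Hom.preimage_inf, V.2.2, W.2.2]⟩
    have hx : c V x ∈ V.1 := by rw [← V.opensRange_chart]; exact ⟨x, rfl⟩
    have hy : c W y ∈ W.1 := by rw [← W.opensRange_chart]; exact ⟨y, rfl⟩
    have hL : c V x ∈ L.1 := ⟨hx, hxy ▸ hy⟩
    rw [← L.opensRange_chart] at hL
    obtain ⟨z, hz⟩ := hL
    refine ⟨L, homOfLE (inf_le_left (a := V.1) (b := W.1)),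
      homOfLE (inf_le_right (a := V.1) (b := W.1)), z, ?_, ?_⟩
    · apply (c V).isOpenEmbedding.injective
      rw [← Scheme.Hom.comp_apply, hw]
      exact hz
    · apply (c W).isOpenEmbedding.injective
      rw [← Scheme.Hom.comp_apply, hw]
      exact hz.trans hxy
  have := isLocallyDirected_of_charts (quotientMap φ) hq hs c hw hdir
  have hcov' (y : Y) : ∃ (V : StableAffineOpens φ) (x : (spectra φ).obj V), c V x = y := by
    obtain ⟨V, hV⟩ := hcov y
    rw [← V.opensRange_chart] at hV
    exact ⟨V, hV⟩
  obtain ⟨p, hp⟩ := exists_desc_of_charts (quotientMap φ) hq c hw hdir hcov'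
  let s : Cocone (quotients φ) := ⟨Spec (.of k), fun V ↦ V.structureMap F hr, fun V W f ↦ by
    rw [map_structureMap]; exact (Category.comp_id _).symm⟩
  let π : colimit (quotients φ) ⟶ Spec (.of k) := colimit.desc (quotients φ) s
  have hπ (V : StableAffineOpens φ) : colimit.ι (quotients φ) V ≫ π = V.structureMap F hr :=
    colimit.ι_desc s V
  let 𝒰 : Y.OpenCover :=
    { I₀ := StableAffineOpens φ, X := (spectra φ).obj, f := c
      mem₀ := by
        rw [Scheme.presieve₀_mem_precoverage_iff]
        exact ⟨hcov', inferInstance⟩ }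
  have hφ (V : StableAffineOpens φ) : c V ≫ φ ≫ p = c V ≫ p := by
    rw [← Category.assoc, V.chart_comp, Category.assoc, (hp V).w, ← Category.assoc,
      specEnd_comp_quotientMap]
  have hc (V : StableAffineOpens φ) :
      c V ≫ p ≫ π = c V ≫ r ≫ Spec.map (CommRingCat.ofHom (algebraMap k K)) := by
    rw [← Category.assoc, (hp V).w, Category.assoc, hπ, (hpb V).w, Category.assoc]
  refine ⟨colimit (quotients φ), π, p, 𝒰.hom_ext _ _ hφ, ?_⟩
  refine isPullback_of_charts (𝒰.hom_ext _ _ hc) c (colimit.ι (quotients φ))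
    (Scheme.IsLocallyDirected.ι_jointly_surjective _) ((quotientMap φ).app ·) hp fun V ↦ ?_
  rw [hπ]
  exact hpb V

end Quotient

end QuotStack

end

noncomputable section

namespace QuotStack

/-! ### Descending the torsor structure and the map to `X` -/

section Torsor

open Module

theorem isPullback_whiskerLeft_snd {C : Type w} [Category.{v} C] [CartesianMonoidalCategory C]
    (G : C) {Y T : C} (p : Y ⟶ T) : IsPullback (G ◁ p) (snd G Y) (snd G T) p := by
  refine ⟨⟨by simp⟩, ⟨PullbackCone.IsLimit.mk _ (fun s ↦ lift (s.fst ≫ fst G T) s.snd) ?_ ?_ ?_⟩⟩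
  · intro s
    ext
    · simp
    · simpa using s.condition.symm
  · intro s
    simp
  · intro s m h₁ h₂
    ext
    · simp [← h₁]
    · simpa using h₂

variable {k k' K : Type u} [Field k] [Field k'] [Field K] [Algebra k k'] [Algebra k K]
  [Algebra k' K] [IsScalarTower k k' K] {N : ℕ} [NeZero N]

variable (k k' K) in
/-- The morphism `Spec K → Spec k'` over `k` of a tower `k ⊆ k' ⊆ K`. -/
abbrev towerMap : specOver k K ⟶ specOver k k' := specMap (IsScalarTower.toAlgHom k k' K)

section Descent

variable {Z Z' W : Over (Spec (.of k))} {q : Z' ⟶ Z} {r : Z' ⟶ specOver k K} {z : Z ⟶ specOver k k'}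

theorem isPullback_left (h : IsPullback q r z (towerMap k k' K)) :
    IsPullback q.left r.left z.left (Spec.map (CommRingCat.ofHom (algebraMap k' K))) :=
  h.map (Over.forget _)

theorem epi_of_isPullback (h : IsPullback q r z (towerMap k k' K)) : Epi q := by
  obtain ⟨_, _, _⟩ := flat_of_isPullback (isPullback_left h)
  have : Epi q.left := inferInstance
  exact (Over.forget _).epi_of_epi_map this

theorem exists_desc_over (hd : finrank k' K = N) (F : K →ₐ[k'] K) (hF : orderOf F = N)
    (h : IsPullback q r z (towerMap k k' K)) (φ : Z' ⟶ Z') (hq : φ ≫ q = q)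
    (hr : φ ≫ r = r ≫ specMap (F.restrictScalars k)) (f : Z' ⟶ W) (hf : φ ≫ f = f) :
    ∃ f' : Z ⟶ W, q ≫ f' = f := by
  obtain ⟨f', hf'⟩ := exists_desc_of_invariant hd F hF (isPullback_left h) φ.left
    (congrArg (·.left) hq) (congrArg (·.left) hr) f.left (congrArg (·.left) hf)
  obtain ⟨_, _, _⟩ := flat_of_isPullback (isPullback_left h)
  have : Epi q.left := inferInstance
  refine ⟨Over.homMk f' ?_, by ext1; exact hf'⟩
  rw [← cancel_epi q.left, ← Category.assoc, hf', Over.w, Over.w]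

end Descent

variable {G X : Over (Spec (.of k))} [GrpObj G] [ModObj G X]

/-- The semilinear endomorphism `(a, t) ↦ (a g(t)⁻¹, F t)` of `G_K`. -/
def twist (F : K →ₐ[k'] K) (g : specOver k K ⟶ G) : G ⊗ specOver k K ⟶ G ⊗ specOver k K :=
  lift (fst G _ * (snd G _ ≫ g)⁻¹) (snd G _ ≫ specMap (F.restrictScalars k))

/-- A descent of `G_K` along a twist carries an object of the quotient stack. -/
theorem exists_quotientStack_of_descent [LocallyOfFiniteType G.hom] (hd : finrank k' K = N)
    (F : K →ₐ[k'] K) (hF : orderOf F = N) (x : specOver k K ⟶ X) (g : specOver k K ⟶ G)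
    (hx : specMap (F.restrictScalars k) ≫ x = g • x) {T : Over (Spec (.of k))}
    (π : T ⟶ specOver k k') (p : G ⊗ specOver k K ⟶ T) (hp : twist F g ≫ p = p)
    (hpb : IsPullback p (snd G _) π (towerMap k k' K)) :
    ∃ (M : QuotientStack G X (specOver k k')) (t : specOver k K ⟶ M.T),
      t ≫ M.π = towerMap k k' K ∧ t ≫ M.f = x := by
  let E := specOver k K
  let s : E ⟶ E := specMap (F.restrictScalars k)
  have hs : s ≫ towerMap k k' K = towerMap k k' K := by
    rw [← specMap_comp]
    congr 1
    ext a
    exact F.commutes a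
  have hφ {Z : Over (Spec (.of k))} (t : Z ⟶ G ⊗ E) : t ≫ twist F g =
      lift ((t ≫ fst G E) * (t ≫ snd G E ≫ g)⁻¹) (t ≫ snd G E ≫ s) := by
    simp only [twist, comp_lift, MonObj.comp_mul, GrpObj.comp_inv, E, s]
  -- Points of `T` lift to `G_K` after an epimorphism, so identities on `T` can be checked by
  -- explicit formulas on `G_K`.
  have hlift {Z : Over (Spec (.of k))} (t : Z ⟶ T) : ∃ (Z' : Over (Spec (.of k))) (q : Z' ⟶ Z)
      (t' : Z' ⟶ G ⊗ E), Epi q ∧ t' ≫ p = q ≫ t :=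
    ⟨pullback (t ≫ π) (towerMap k k' K), pullback.fst _ _,
      hpb.lift (pullback.fst _ _ ≫ t) (pullback.snd _ _) (by simp [pullback.condition]),
      epi_of_isPullback (IsPullback.of_hasPullback _ _), hpb.lift_fst _ _ _⟩
  let aY : G ⊗ (G ⊗ E) ⟶ G ⊗ E :=
    lift (fst G (G ⊗ E) * (snd G (G ⊗ E) ≫ fst G E)) (snd G (G ⊗ E) ≫ snd G E)
  have haY {Z : Over (Spec (.of k))} (h : Z ⟶ G) (t : Z ⟶ G ⊗ E) :
      lift h t ≫ aY = lift (h * (t ≫ fst G E)) (t ≫ snd G E) := by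
    simp [aY, comp_lift, MonObj.comp_mul]
  -- The action descends because the twist multiplies on the right and so commutes with left
  -- translations.
  obtain ⟨a, ha⟩ : ∃ a : G ⊗ T ⟶ T, G ◁ p ≫ a = aY ≫ p := by
    have h := (isPullback_whiskerLeft_snd G p).flip.paste_horiz hpb.flip
    refine exists_desc_over hd F hF h.flip (G ◁ twist F g) ?_ ?_ _ ?_
    · rw [← whiskerLeft_comp, hp]
    · simp [twist]
    · have : G ◁ twist F g ≫ aY = aY ≫ twist F g := by
        have h₁ : G ◁ twist F g = lift (fst G (G ⊗ E)) (snd G (G ⊗ E) ≫ twist F g) := by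
          ext1 <;> simp <;> rfl
        have h₂ : aY = lift (fst G (G ⊗ E)) (snd G (G ⊗ E)) ≫ aY := by simp
        rw [h₁, haY, hφ, h₂, haY, hφ]
        simp [mul_assoc]
      rw [reassoc_of% this, hp]
  have ha' {Z : Over (Spec (.of k))} (h : Z ⟶ G) (t : Z ⟶ G ⊗ E) :
      lift h (t ≫ p) ≫ a = lift (h * (t ≫ fst G E)) (t ≫ snd G E) ≫ p := by
    rw [← haY, Category.assoc, ← ha, ← Category.assoc, lift_whiskerLeft]
  let : ModObj G T := actionOfPoints a
    (fun {Z} t ↦ by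
      obtain ⟨Z', q, t', _, ht'⟩ := hlift t
      rw [← cancel_epi q, comp_lift_assoc, ← ht', ha', MonObj.comp_one, one_mul, ← comp_lift,
        lift_fst_snd, Category.comp_id])
    (fun {Z} h₁ h₂ t ↦ by
      obtain ⟨Z', q, t', _, ht'⟩ := hlift t
      rw [← cancel_epi q, comp_lift_assoc, comp_lift_assoc, comp_lift_assoc, ← ht', ha', ha', ha',
        MonObj.comp_mul, lift_fst, lift_snd, mul_assoc])
  have hsmul {Z : Over (Spec (.of k))} (h : Z ⟶ G) (t : Z ⟶ G ⊗ E) :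
      h • (t ≫ p) = lift (h * (t ≫ fst G E)) (t ≫ snd G E) ≫ p := ha' h t
  -- The orbit map is invariant: `(a g⁻¹) · F x = a g⁻¹ g x = a x`.
  obtain ⟨f, hf⟩ : ∃ f : T ⟶ X, p ≫ f = fst G E • (snd G E ≫ x) := by
    refine exists_desc_over hd F hF hpb (twist F g) hp (lift_snd _ _) _ ?_
    have h₁ : twist F g ≫ fst G E = fst G E * (snd G E ≫ g)⁻¹ := lift_fst _ _
    have h₂ : twist F g ≫ snd G E = snd G E ≫ s := lift_snd _ _
    rw [ModObj.comp_smul, h₁, reassoc_of% h₂, hx, ModObj.comp_smul, ← mul_smul,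
      inv_mul_cancel_right]
  have hf' {Z : Over (Spec (.of k))} (t : Z ⟶ G ⊗ E) :
      t ≫ p ≫ f = (t ≫ fst G E) • (t ≫ snd G E ≫ x) := by
    rw [hf, ModObj.comp_smul]
  have hinv {Z : Over (Spec (.of k))} (h : Z ⟶ G) (t : Z ⟶ T) : (h • t) ≫ π = t ≫ π := by
    obtain ⟨Z', q, t', _, ht'⟩ := hlift t
    rw [← cancel_epi q, ← Category.assoc, ModObj.comp_smul, ← ht', hsmul, Category.assoc, hpb.w,
      lift_snd_assoc, ← Category.assoc q, ← ht', Category.assoc, Category.assoc, hpb.w]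
  have htors : IsTorsor G π :=
    { flat := inferInstanceAs (Flat (Y := Spec (.of k')) π.left)
      surjective := by
        have : Nonempty T.left :=
          ⟨(lift 1 (𝟙 E) ≫ p).left (IsLocalRing.closedPoint K : Spec (.of K))⟩
        exact ⟨Function.surjective_to_subsingleton (α := T.left) (β := Spec (.of k')) _⟩
      locallyOfFinitePresentation := by
        have : Surjective (Spec.map (CommRingCat.ofHom (algebraMap k' K))) :=
          ⟨Function.surjective_to_subsingleton (α := Spec (.of K)) (β := Spec (.of k')) _⟩
        have hfl : Flat (Spec.map (CommRingCat.ofHom (algebraMap k' K))) :=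
          inferInstanceAs (Flat (Y := Spec (.of k')) _)
        have hqc : QuasiCompact (Spec.map (CommRingCat.ofHom (algebraMap k' K))) :=
          inferInstance
        refine MorphismProperty.of_isPullback_of_descendsAlong (P := @LocallyOfFinitePresentation)
          (Q := @Surjective ⊓ @Flat ⊓ @QuasiCompact) (isPullback_left hpb).flip
          ⟨⟨this, hfl⟩, hqc⟩ ?_
        change LocallyOfFinitePresentation (pullback.snd G.hom (specOver k K).hom)
        infer_instance
      isPullback := by
        refine (isPullback_iff _).mpr ⟨?_, fun {Z} b₁ b₂ hb ↦ ?_⟩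
        · have := hinv (fst G T) (snd G T)
          simpa only [Hom.smul_def, lift_fst_snd, Category.id_comp] using this
        · let q : pullback (b₁ ≫ π) (towerMap k k' K) ⟶ Z := pullback.fst _ _
          let r : pullback (b₁ ≫ π) (towerMap k k' K) ⟶ E := pullback.snd _ _
          have hqr : IsPullback q r (b₁ ≫ π) (towerMap k k' K) := IsPullback.of_hasPullback _ _
          have := epi_of_isPullback hqr
          let t₁ := hpb.lift (q ≫ b₁) r (by simpa using hqr.w)
          let t₂ := hpb.lift (q ≫ b₂) r (by simpa [← hb] using hqr.w)
          have h₁ : t₁ ≫ p = q ≫ b₁ := hpb.lift_fst _ _ _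
          have h₂ : t₂ ≫ p = q ≫ b₂ := hpb.lift_fst _ _ _
          have h₁' : t₁ ≫ snd G E = r := hpb.lift_snd _ _ _
          have h₂' : t₂ ≫ snd G E = r := hpb.lift_snd _ _ _
          -- The Frobenius on the second factor of `Z ×_{k'} K`. It turns both lifts `t₁`, `t₂` into
          -- their twists, so the right factor `g⁻¹` cancels in `t₁ t₂⁻¹`, which therefore descends
          -- to a point of `G` over `Z`.
          let ψ : pullback (b₁ ≫ π) (towerMap k k' K) ⟶ pullback (b₁ ≫ π) (towerMap k k' K) :=
            hqr.lift q (r ≫ s) (by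
              rw [Category.assoc, hs]
              exact hqr.w)
          have hψq : ψ ≫ q = q := hqr.lift_fst _ _ _
          have hψr : ψ ≫ r = r ≫ s := hqr.lift_snd _ _ _
          have hψ₁ : ψ ≫ t₁ = t₁ ≫ twist F g := by
            apply hpb.hom_ext
            · rw [Category.assoc, Category.assoc, hp, h₁, reassoc_of% hψq]
            · rw [Category.assoc, h₁', hψr, hφ, lift_snd, reassoc_of% h₁']
          have hψ₂ : ψ ≫ t₂ = t₂ ≫ twist F g := by
            apply hpb.hom_ext
            · rw [Category.assoc, Category.assoc, hp, h₂, reassoc_of% hψq]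
            · rw [Category.assoc, h₂', hψr, hφ, lift_snd, reassoc_of% h₂']
          obtain ⟨h, hh⟩ := exists_desc_over hd F hF hqr ψ hψq hψr
            ((t₁ ≫ fst G E) * (t₂ ≫ fst G E)⁻¹) (by
              rw [MonObj.comp_mul, GrpObj.comp_inv, ← Category.assoc, ← Category.assoc, hψ₁, hψ₂,
                hφ, hφ, lift_fst, lift_fst, reassoc_of% h₁', reassoc_of% h₂']
              simp)
          refine ⟨h, ?_, fun h' hh' ↦ ?_⟩
          · change h • b₂ = b₁
            rw [← cancel_epi q, ModObj.comp_smul, ← h₂, hsmul, hh, inv_mul_cancel_right, h₂', ← h₁',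
              ← comp_lift, lift_fst_snd, Category.comp_id, h₁]
          · have e : q ≫ (h' • b₂) = q ≫ b₁ := congrArg (q ≫ ·) hh'
            rw [ModObj.comp_smul, ← h₂, hsmul, ← h₁] at e
            have e' := hpb.hom_ext e (by rw [lift_snd, h₁', h₂'])
            have e'' := (lift_fst _ _).symm.trans (congrArg (· ≫ fst G E) e')
            rw [← cancel_epi q, hh, ← e'', mul_inv_cancel_right] }
  have hequiv : IsModHom G f := isModHom_of_points _ fun {Z} h t ↦ by
    obtain ⟨Z', q, t', _, ht'⟩ := hlift t
    rw [← cancel_epi q, ← Category.assoc, ModObj.comp_smul, ModObj.comp_smul, ← Category.assoc q,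
      ← ht', hsmul, Category.assoc, hf', Category.assoc, hf', lift_fst, lift_snd_assoc, mul_smul,
      Category.assoc]
  -- The point over `x` is the image of the unit section of `G_K`.
  refine ⟨{ T := T, π := π, torsor := htors, f := f }, lift 1 (𝟙 E) ≫ p, ?_, ?_⟩
  · change (lift 1 (𝟙 E) ≫ p) ≫ π = _
    rw [Category.assoc, hpb.w, lift_snd_assoc, Category.id_comp]
  · change (lift 1 (𝟙 E) ≫ p) ≫ f = _
    rw [Category.assoc, hf', lift_fst, lift_snd_assoc, Category.id_comp, one_smul]

end Torsor

end QuotStack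

end

noncomputable section

namespace QuotStack

/-! ### Points over finite fields and fields of definition -/

section FieldPoints

variable {k : Type u} [Field k]

theorem epi_specMap {K L : Type u} [Field K] [Field L] [Algebra k K] [Algebra k L] (f : K →ₐ[k] L) :
    Epi (specMap f) := by
  let := f.toRingHom.toAlgebra
  have : Surjective (Spec.map (CommRingCat.ofHom f.toRingHom)) :=
    ⟨Function.surjective_to_subsingleton (α := Spec (.of L)) (β := Spec (.of K)) _⟩
  have : Flat (Spec.map (CommRingCat.ofHom f.toRingHom)) :=
    inferInstanceAs (Flat (Y := Spec (.of K)) _)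
  have : Epi (specMap f).left :=
    inferInstanceAs (Epi (Spec.map (CommRingCat.ofHom f.toRingHom)))
  exact (Over.forget _).epi_of_epi_map this

theorem exists_specOver_hom {Z : Over (Spec (.of k))} (A : CommRingCat.{u})
    (j : Spec A ⟶ Z.left) : ∃ (_ : Algebra k A) (j' : specOver k A ⟶ Z), j'.left = j := by
  let := (Spec.preimage (j ≫ Z.hom)).hom.toAlgebra
  exact ⟨this, Over.homMk j (Spec.map_preimage (j ≫ Z.hom)).symm, rfl⟩

theorem exists_specMap_eq {A B : Type u} [CommRing A] [CommRing B] [Algebra k A] [Algebra k B]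
    (h : specOver k B ⟶ specOver k A) : ∃ f : A →ₐ[k] B, specMap f = h := by
  let f := (Spec.preimage h.left).hom
  have hf : Spec.map (CommRingCat.ofHom f) = h.left := Spec.map_preimage h.left
  refine ⟨{ f with commutes' := fun r ↦ ?_ }, ?_⟩
  · have := Over.w h
    change h.left ≫ Spec.map (CommRingCat.ofHom (algebraMap k A)) =
      Spec.map (CommRingCat.ofHom (algebraMap k B)) at this
    rw [← hf, ← Spec.map_comp, ← CommRingCat.ofHom_comp] at this
    have := Spec.map_injective this
    exact congrArg (fun g ↦ g.hom r) this
  · ext1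
    exact hf

theorem specMap_injective {A B : Type u} [CommRing A] [CommRing B] [Algebra k A] [Algebra k B] :
    Function.Injective (specMap (k := k) (A := A) (B := B)) := by
  intro f g h
  have := Spec.map_injective (congrArg (·.left) h)
  ext r
  exact congrArg (fun g ↦ g.hom r) this

/-- A point with values in a field factors through any chart containing its image. -/
theorem exists_specMap_comp_eq {Z : Over (Spec (.of k))} {A L : Type u} [CommRing A] [Field L]
    [Algebra k A] [Algebra k L] (j : specOver k A ⟶ Z) (hj : IsOpenImmersion j.left)
    (z : specOver k L ⟶ Z)
    (hz : z.left (IsLocalRing.closedPoint L : Spec (.of L)) ∈ Set.range j.left) :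
    ∃ f : A →ₐ[k] L, specMap f ≫ j = z := by
  have hr : Set.range z.left ⊆ Set.range j.left := by
    rintro _ ⟨y, rfl⟩
    have : y = (IsLocalRing.closedPoint L : Spec (.of L)) :=
      Subsingleton.elim (α := Spec (.of L)) _ _
    rwa [this]
  obtain ⟨f, hf⟩ := exists_specMap_eq (k := k) (A := A) (B := L)
    (Over.homMk (IsOpenImmersion.lift j.left z.left hr) (by
      rw [← Over.w j, IsOpenImmersion.lift_fac_assoc, Over.w]))
  refine ⟨f, ?_⟩
  rw [hf]
  ext1
  exact IsOpenImmersion.lift_fac _ _ _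

theorem finiteType_of_isOpenImmersion {Z : Over (Spec (.of k))} [LocallyOfFiniteType Z.hom]
    {A : Type u} [CommRing A] [Algebra k A] (j : specOver k A ⟶ Z) (hj : IsOpenImmersion j.left) :
    Algebra.FiniteType k A := by
  have : LocallyOfFiniteType (Spec.map (CommRingCat.ofHom (algebraMap k A))) := by
    have h := Over.w j
    change _ = Spec.map (CommRingCat.ofHom (algebraMap k A)) at h
    rw [← h]
    infer_instance
  have := HasRingHomProperty.Spec_iff.mp this
  exact RingHom.finiteType_algebraMap.mp this

theorem exists_chart {Z : Over (Spec (.of k))} {L : Type u} [Field L] [Algebra k L]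
    (z : specOver k L ⟶ Z) : ∃ (A : CommRingCat.{u}) (_ : Algebra k A) (j : specOver k A ⟶ Z)
      (f : A →ₐ[k] L), IsOpenImmersion j.left ∧ specMap f ≫ j = z := by
  let y := z.left (IsLocalRing.closedPoint L : Spec (.of L))
  obtain ⟨R, j, hj, hy⟩ : ∃ (R : CommRingCat.{u}) (j : Spec R ⟶ Z.left), IsOpenImmersion j ∧
      y ∈ Set.range j := by
    obtain ⟨i, x, hx⟩ := Z.left.affineCover.exists_eq y
    exact ⟨_, Z.left.affineCover.f i, Z.left.affineCover.map_prop i, x, hx⟩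
  obtain ⟨_, j', rfl⟩ := exists_specOver_hom R j
  obtain ⟨f, hf⟩ := exists_specMap_comp_eq j' hj z hy
  exact ⟨R, _, j', f, hj, hf⟩

theorem finite_algHom {A L : Type*} [CommRing A] [Algebra k A] [Algebra.FiniteType k A] [Field L]
    [Algebra k L] [Finite L] : Finite (A →ₐ[k] L) := by
  obtain ⟨s, hs⟩ := Algebra.FiniteType.out (R := k) (A := A)
  refine Finite.of_injective (fun f : A →ₐ[k] L ↦ fun a : s ↦ f a) fun f g h ↦ ?_
  exact AlgHom.ext_of_adjoin_eq_top hs fun a ha ↦ congrFun h ⟨a, ha⟩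

/-- A scheme of finite type has finitely many points over a finite field. -/
theorem finite_points (Z : Over (Spec (.of k))) [LocallyOfFiniteType Z.hom] [QuasiCompact Z.hom]
    (L : Type u) [Field L] [Algebra k L] [Finite L] : Finite (specOver k L ⟶ Z) := by
  have : CompactSpace Z.left := (quasiCompact_iff_compactSpace (f := Z.hom)).mp ‹_›
  let 𝒰 := Z.left.affineCover.finiteSubcover
  have key (i : 𝒰.I₀) : {z : specOver k L ⟶ Z |
      z.left (IsLocalRing.closedPoint L : Spec (.of L)) ∈ Set.range (𝒰.f i)}.Finite := by
    obtain ⟨R, j, hj, hr⟩ : ∃ (R : CommRingCat.{u}) (j : Spec R ⟶ Z.left), IsOpenImmersion j ∧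
      Set.range j = Set.range (𝒰.f i) := ⟨_, 𝒰.f i, 𝒰.map_prop i, rfl⟩
    obtain ⟨_, j', rfl⟩ := exists_specOver_hom R j
    have := finiteType_of_isOpenImmersion j' hj
    have := finite_algHom (k := k) (A := R) (L := L)
    refine (Set.finite_range fun f : R →ₐ[k] L ↦ specMap f ≫ j').subset fun z hz ↦ ?_
    exact exists_specMap_comp_eq j' hj z (hr ▸ hz)
  refine Set.finite_univ_iff.mp ((Set.finite_iUnion key).subset fun z _ ↦ ?_)
  obtain ⟨i, x, hx⟩ := 𝒰.exists_eq (z.left (IsLocalRing.closedPoint L : Spec (.of L)))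
  exact Set.mem_iUnion.mpr ⟨i, x, hx⟩

variable {k' kbar : Type u} [Field k'] [Field kbar] [Algebra k k'] [Algebra k kbar]
  [Algebra k' kbar] [IsScalarTower k k' kbar]

/-- The morphism `Spec k̄ → Spec K` of a subextension `K`. -/
abbrev subMap (K : IntermediateField k' kbar) : specOver k kbar ⟶ specOver k K :=
  specMap (K.val.restrictScalars k)

theorem exists_subMap_comp_eq_of_le {Z : Over (Spec (.of k))} {K L : IntermediateField k' kbar}
    (h : K ≤ L) (z : specOver k K ⟶ Z) :
    ∃ z' : specOver k L ⟶ Z, subMap L ≫ z' = subMap (k := k) K ≫ z := by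
  refine ⟨specMap ((IntermediateField.inclusion h).restrictScalars k) ≫ z, ?_⟩
  rw [← Category.assoc, ← specMap_comp]
  rfl

theorem exists_subMap_comp_eq {Z : Over (Spec (.of k))} {A : Type u} [CommRing A] [Algebra k A]
    (j : specOver k A ⟶ Z) (f : A →ₐ[k] kbar) (K : IntermediateField k' kbar)
    (h : ∀ a, f a ∈ K) : ∃ z : specOver k K ⟶ Z, subMap K ≫ z = specMap f ≫ j := by
  let f' : A →ₐ[k] K := f.codRestrict (K.toSubalgebra.restrictScalars k) h
  refine ⟨specMap f' ≫ j, ?_⟩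
  rw [← Category.assoc, ← specMap_comp]
  rfl

/-- A geometric point of a scheme locally of finite type is defined over a finite extension. -/
theorem exists_finite_level [Algebra.IsAlgebraic k' kbar] {Z : Over (Spec (.of k))}
    [LocallyOfFiniteType Z.hom] (z : specOver k kbar ⟶ Z) :
    ∃ (K : IntermediateField k' kbar) (_ : FiniteDimensional k' K) (z' : specOver k K ⟶ Z),
      subMap K ≫ z' = z := by
  obtain ⟨A, _, j, f, hj, rfl⟩ := exists_chart z
  have := finiteType_of_isOpenImmersion j hj
  obtain ⟨s, hs⟩ := Algebra.FiniteType.out (R := k) (A := A)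
  have : Finite (f '' s) := (s.finite_toSet.image f).to_subtype
  let K := IntermediateField.adjoin k' (f '' s)
  have hK : FiniteDimensional k' K :=
    IntermediateField.finiteDimensional_adjoin fun x _ ↦ Algebra.IsIntegral.isIntegral x
  refine ⟨K, hK, exists_subMap_comp_eq j f K fun a ↦ ?_⟩
  have ha : a ∈ Algebra.adjoin k (s : Set A) := hs ▸ Algebra.mem_top
  have : Algebra.adjoin k (s : Set A) ≤ (K.toSubalgebra.restrictScalars k).comap f :=
    Algebra.adjoin_le fun b hb ↦ IntermediateField.subset_adjoin _ _ ⟨b, hb, rfl⟩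
  exact this ha

section Frobenius

variable [Fintype k']

open FiniteField

variable (k) in
/-- The Frobenius of a `k'`-algebra over the finite field `k'`, as an endomorphism of its spectrum. -/
abbrev frob (k' : Type u) [Field k'] [Fintype k'] [Algebra k k'] (A : Type u) [CommRing A]
    [Algebra k' A] [Algebra k A] [IsScalarTower k k' A] : specOver k A ⟶ specOver k A :=
  specMap ((frobeniusAlgHom k' A).restrictScalars k)

theorem subMap_frob (K : IntermediateField k' kbar) :
    frob k k' kbar ≫ subMap K = subMap K ≫ frob k k' K := by
  rw [← specMap_comp, ← specMap_comp]
  rfl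

theorem iter_frob (A : Type u) [CommRing A] [Algebra k' A] [Algebra k A] [IsScalarTower k k' A]
    (n : ℕ) : iter (frob k k' A) n = specMap ((frobeniusAlgHom k' A ^ n).restrictScalars k) := by
  induction n with
  | zero => exact (specMap_id A).symm
  | succ n ih =>
    change _ ≫ iter _ n = _
    rw [ih, ← specMap_comp, pow_succ']
    rfl

/-- A geometric point fixed by a power of the Frobenius is defined over a finite extension. -/
theorem exists_finite_level_of_frob [Algebra.IsAlgebraic k' kbar] {Z : Over (Spec (.of k))}
    (z : specOver k kbar ⟶ Z) {n : ℕ} (hn : 0 < n) (hz : iter (frob k k' kbar) n ≫ z = z) :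
    ∃ (K : IntermediateField k' kbar) (_ : FiniteDimensional k' K) (z' : specOver k K ⟶ Z),
      subMap K ≫ z' = z := by
  obtain ⟨A, _, j, f, hj, rfl⟩ := exists_chart z
  have : Mono j := (Over.forget _).mono_of_mono_map (inferInstanceAs (Mono j.left))
  rw [iter_frob, ← Category.assoc, cancel_mono, ← specMap_comp] at hz
  have hf := specMap_injective hz
  -- The coordinates of the point are fixed by the `n`-th power of the Frobenius, hence are roots of
  -- one polynomial. This replaces finite generation of `A`, which is not available here.
  let s : Set kbar := {a | a ^ Fintype.card k' ^ n = a}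
  have hs : s.Finite := by
    have h1 : 1 < Fintype.card k' ^ n := Nat.one_lt_pow hn.ne' Fintype.one_lt_card
    have h0 := FiniteField.X_pow_card_sub_X_ne_zero kbar h1
    refine (Polynomial.rootSet_finite (Polynomial.X ^ Fintype.card k' ^ n - Polynomial.X) kbar).subset
      fun a ha ↦ (Polynomial.mem_rootSet_of_ne h0).mpr ?_
    have ha' : a ^ Fintype.card k' ^ n = a := ha
    simp [ha']
  have : Finite s := hs.to_subtype
  let K := IntermediateField.adjoin k' s
  have hK : FiniteDimensional k' K :=
    IntermediateField.finiteDimensional_adjoin fun x _ ↦ Algebra.IsIntegral.isIntegral x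
  refine ⟨K, hK, exists_subMap_comp_eq j f K fun a ↦ IntermediateField.subset_adjoin _ _ ?_⟩
  have := DFunLike.congr_fun hf a
  change (frobeniusAlgHom k' kbar ^ n) (f a) = f a at this
  rwa [AlgHom.coe_pow, coe_frobeniusAlgHom, pow_iterate] at this

end Frobenius

/-- A finite field has a subextension of its algebraic closure of any given positive degree. -/
theorem exists_finrank_eq (k' kbar : Type*) [Field k'] [Field kbar] [Algebra k' kbar] [Finite k']
    [IsAlgClosed kbar] (n : ℕ) [NeZero n] :
    ∃ K : IntermediateField k' kbar, FiniteDimensional k' K ∧ Module.finrank k' K = n := by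
  obtain ⟨p, _⟩ := CharP.exists k'
  have : Fact p.Prime := ⟨CharP.char_is_prime k' p⟩
  let f : FiniteField.Extension k' p n →ₐ[k'] kbar := IsAlgClosed.lift
  let e : FiniteField.Extension k' p n ≃ₗ[k'] f.fieldRange :=
    (AlgEquiv.ofInjectiveField f).toLinearEquiv
  exact ⟨f.fieldRange, Module.Finite.equiv e,
    e.finrank_eq.symm.trans (FiniteField.finrank_extension k' p n)⟩

end FieldPoints

theorem comp_iter {C : Type*} [Category* C] {S S' : C} {s : S ⟶ S} {s' : S' ⟶ S'} {j : S' ⟶ S} (h : s' ≫ j = j ≫ s) (i : ℕ) :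
    iter s' i ≫ j = j ≫ iter s i := by
  induction i with
  | zero => simp [iter]
  | succ i ih => simp only [iter, Category.assoc, ih, reassoc_of% h]

/-! ### Periodicity of the norms -/

section Norm

variable {C : Type w} [Category.{v} C] [CartesianMonoidalCategory C] {G X S S' : C} [GrpObj G]
  [ModObj G X]

/-- The products `g_i = s^{i-1}(g) ⋯ s(g) g`, for an endomorphism `s` of `S` and `g ∈ G(S)`. -/
def normIter (s : S ⟶ S) (g : S ⟶ G) : ℕ → (S ⟶ G)
  | 0 => 1
  | i + 1 => (s ≫ normIter s g i) * g

theorem comp_normIter {s : S ⟶ S} {s' : S' ⟶ S'} {j : S' ⟶ S} (h : s' ≫ j = j ≫ s) (g : S ⟶ G)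
    (i : ℕ) : j ≫ normIter s g i = normIter s' (j ≫ g) i := by
  induction i with
  | zero => exact MonObj.comp_one _
  | succ i ih =>
    change j ≫ ((s ≫ normIter s g i) * g) = (s' ≫ normIter s' (j ≫ g) i) * (j ≫ g)
    rw [MonObj.comp_mul, ← ih, reassoc_of% h]

theorem iter_comp_eq_smul {s : S ⟶ S} {g : S ⟶ G} {x : S ⟶ X} (h : s ≫ x = g • x) (i : ℕ) :
    iter s i ≫ x = normIter s g i • x := by
  induction i with
  | zero => simp [iter, normIter]
  | succ i ih => simp only [iter, normIter, Category.assoc, ih, ModObj.comp_smul, h, mul_smul]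

theorem normIter_eq_iterate (s : S ⟶ S) (g : S ⟶ G) (i : ℕ) :
    normIter s g i = (fun z ↦ (s ≫ z) * g)^[i] 1 := by
  induction i with
  | zero => rfl
  | succ i ih => rw [Function.iterate_succ_apply', ← ih]; rfl

/-- The norms are the orbit of `1` under `z ↦ s(z) g`, which is injective since `s` is epi. A finite
orbit of an injective map has no preperiod, so it returns to `1`. -/
theorem exists_normIter_eq_one (s : S ⟶ S) [Epi s] (g : S ⟶ G)
    (h : (Set.range (normIter s g)).Finite) :
    ∃ n, 0 < n ∧ ∀ m, n ∣ m → normIter s g m = 1 := by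
  let θ : (S ⟶ G) → (S ⟶ G) := fun z ↦ (s ≫ z) * g
  have hθ : Function.Injective θ := fun a b hab ↦ by
    rwa [mul_left_inj, cancel_epi] at hab
  have hi (i : ℕ) : normIter s g i = θ^[i] 1 := normIter_eq_iterate s g i
  have hni : ¬ Function.Injective (normIter s g) := fun hinj ↦
    Set.infinite_range_of_injective hinj h
  obtain ⟨i, j, hij, hlt⟩ : ∃ i j, normIter s g i = normIter s g j ∧ i < j := by
    simp only [Function.Injective, not_forall] at hni
    obtain ⟨i, j, hij, hne⟩ := hni
    rcases lt_or_gt_of_ne hne with h | h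
    · exact ⟨i, j, hij, h⟩
    · exact ⟨j, i, hij.symm, h⟩
  have hp : Function.IsPeriodicPt θ (j - i) 1 := by
    apply hθ.iterate i
    rw [← Function.iterate_add_apply, Nat.add_sub_cancel' hlt.le, ← hi, ← hi, hij]
  refine ⟨j - i, Nat.sub_pos_of_lt hlt, ?_⟩
  rintro _ ⟨m, rfl⟩
  rw [hi]
  exact hp.mul_const m

end Norm

section TwistIter

variable {k k' K : Type u} [Field k] [Field k'] [Field K] [Algebra k k'] [Algebra k K]
  [Algebra k' K] [IsScalarTower k k' K] {G : Over (Spec (.of k))} [GrpObj G]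

/-- This is why the norms appear: the `N`-th iterate of the twist is trivial as soon as `s^N = 1`
and `g_N = 1`. -/
theorem iter_twist (F : K →ₐ[k'] K) (g : specOver k K ⟶ G) (i : ℕ) :
    iter (twist F g) i = lift
      (fst G _ * (snd G _ ≫ normIter (specMap (F.restrictScalars k)) g i)⁻¹)
      (snd G _ ≫ iter (specMap (F.restrictScalars k)) i) := by
  induction i with
  | zero => simp [iter, normIter]
  | succ i ih =>
    rw [iter, ih]
    simp only [iter, twist, normIter, comp_lift, MonObj.comp_mul, GrpObj.comp_inv, lift_fst,
      lift_snd_assoc, Category.assoc, mul_inv_rev, mul_assoc]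

end TwistIter

end QuotStack

end

noncomputable section

namespace QuotStack

/-! ### Separatedness and dense affine opens -/

section Separated

theorem isPullback_diagonal {C : Type w} [Category.{v} C] [CartesianMonoidalCategory C] (G : C)
    [GrpObj G] :
    IsPullback (lift (𝟙 G) (𝟙 G)) (toUnit G) (fst G G * (snd G G)⁻¹) η[G] := by
  have h1 {Z : C} (f : Z ⟶ 𝟙_ C) : f ≫ η[G] = 1 := by
    rw [Hom.one_def]
    congr 1
    exact toUnit_unique _ _
  refine ⟨⟨?_⟩, ⟨PullbackCone.IsLimit.mk _ (fun s ↦ s.fst ≫ fst G G) ?_ ?_ ?_⟩⟩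
  · rw [h1, MonObj.comp_mul, GrpObj.comp_inv, lift_fst, lift_snd, mul_inv_cancel]
  · intro s
    have h := s.condition
    rw [h1, MonObj.comp_mul, GrpObj.comp_inv, mul_inv_eq_one] at h
    ext
    · simp
    · simpa using h
  · intro s
    exact toUnit_unique _ _
  · intro s m h₁ h₂
    simp [← h₁]

variable {k : Type u} [Field k] (G : Over (Spec (.of k))) [GrpObj G]

/-- The diagonal is the base change of the unit section along `(a, b) ↦ a b⁻¹`, and the unit section
of a group over a field is a closed immersion. -/
theorem isSeparated_hom : IsSeparated G.hom := by
  have h := (isPullback_diagonal G).map (Over.forget _)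
  have : IsClosedImmersion (lift (𝟙 G) (𝟙 G)).left :=
    MorphismProperty.of_isPullback (P := @IsClosedImmersion) h.flip
      (inferInstanceAs (IsClosedImmersion η[G].left))
  exact ⟨this⟩

/-- Intersections of affine opens of `G_A` are affine. -/
theorem isAffineOpen_inf (A : Type u) [CommRing A] [Algebra k A]
    {U V : (G ⊗ specOver k A).left.Opens} (hU : IsAffineOpen U) (hV : IsAffineOpen V) :
    IsAffineOpen (U ⊓ V) := by
  have := isSeparated_hom G
  have : IsSeparated (snd G (specOver k A)).left :=
    inferInstanceAs (IsSeparated (pullback.snd G.hom (specOver k A).hom))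
  have h : IsSeparated (terminal.from (G ⊗ specOver k A).left) := by
    rw [← terminal.comp_from (snd G (specOver k A)).left]
    have : IsSeparated (terminal.from (specOver k A).left) :=
      inferInstanceAs (IsSeparated (terminal.from (Spec (.of A))))
    infer_instance
  exact hU.inf hV

end Separated

/-- A noetherian scheme has a dense affine open subset. -/
theorem exists_dense_isAffineOpen (Y : Scheme.{u}) [IsNoetherian Y] :
    ∃ U : Y.Opens, IsAffineOpen U ∧ Dense (U : Set Y) := by
  have hw : WellFoundedGT Y.Opens := inferInstanceAs (TopologicalSpace.NoetherianSpace Y)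
  -- A maximal affine open is dense: otherwise a nonempty affine open disjoint from it could be
  -- added, and the disjoint union would still be affine.
  obtain ⟨U, hU, hmax⟩ := hw.wf.has_min {U : Y.Opens | IsAffineOpen U} ⟨⊥, isAffineOpen_bot Y⟩
  refine ⟨U, hU, ?_⟩
  by_contra hd
  rw [dense_iff_closure_eq, ← ne_eq, Set.ne_univ_iff_exists_notMem] at hd
  obtain ⟨y, hy⟩ := hd
  obtain ⟨V, hV, hyV, hVU⟩ := Y.isBasis_affineOpens.exists_subset_of_mem_open hy
    isClosed_closure.isOpen_compl
  obtain ⟨V, hV', rfl⟩ := hV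
  have hdis : Disjoint U V := by
    rw [← TopologicalSpace.Opens.coe_disjoint, Set.disjoint_left]
    exact fun z hz hz' ↦ hVU hz' (subset_closure hz)
  have hsup : IsAffineOpen (U ⊔ V) := by
    rw [sup_eq_iSup]
    refine IsAffineOpen.iSup_of_disjoint (by rintro (_ | _) <;> assumption) ?_
    rintro (_ | _) (_ | _) h
    · exact (h rfl).elim
    · exact hdis.symm
    · exact hdis
    · exact (h rfl).elim
  refine hmax _ hsup (lt_of_le_of_ne le_sup_left fun h ↦ hy (subset_closure ?_))
  have : y ∈ U ⊔ V := Or.inr hyV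
  rwa [← h] at this

/-! ### Two-sided translations and geometric points -/

section Bitranslate

variable {C : Type w} [Category.{v} C] [CartesianMonoidalCategory C] {G S : C} [GrpObj G]

/-- The map `(z, t) ↦ a(t) z b(t)⁻¹`. -/
def bitranslate (a b : S ⟶ G) : G ⊗ S ⟶ G := (snd G S ≫ a) * fst G S * (snd G S ≫ b)⁻¹

theorem lift_bitranslate {Z : C} (a b : S ⟶ G) (z : Z ⟶ G) (t : Z ⟶ S) :
    lift z t ≫ bitranslate a b = (t ≫ a) * z * (t ≫ b)⁻¹ := by
  simp [bitranslate, MonObj.comp_mul, GrpObj.comp_inv]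

instance (a b : S ⟶ G) : IsIso (lift (bitranslate a b) (snd G S)) := by
  have h (a b : S ⟶ G) : lift (bitranslate a b) (snd G S) ≫ lift (bitranslate a⁻¹ b⁻¹) (snd G S) =
      𝟙 _ := by
    ext1
    · rw [Category.assoc, lift_fst, lift_bitranslate]
      simp [bitranslate, GrpObj.comp_inv, mul_assoc]
    · simp
  exact ⟨⟨lift (bitranslate a⁻¹ b⁻¹) (snd G S), h a b, by simpa using h a⁻¹ b⁻¹⟩⟩

end Bitranslate

section ClosedPoints

variable {k : Type u} [Field k] {G : Over (Spec (.of k))} {kbar : Type u} [Field kbar]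
  [Algebra k kbar]

/-- The image of a point with values in a field. -/
def imagePt {Z : Over (Spec (.of k))} {L : Type u} [Field L] [Algebra k L] (z : specOver k L ⟶ Z) :
    Z.left := z.left (IsLocalRing.closedPoint L : Spec (.of L))

theorem imagePt_comp {Z W : Over (Spec (.of k))} {L : Type u} [Field L] [Algebra k L]
    (z : specOver k L ⟶ Z) (f : Z ⟶ W) : imagePt (z ≫ f) = f.left (imagePt z) := by
  rw [imagePt, Over.comp_left]
  rfl

/-- The spectrum of a field has one point. Consequently an open subset of `G` cannot distinguish a
geometric point from its Frobenius conjugates. -/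
theorem imagePt_specMap {Z : Over (Spec (.of k))} {L K : Type u} [Field L] [Algebra k L] [Field K]
    [Algebra k K] (f : specOver k K ⟶ specOver k L) (z : specOver k L ⟶ Z) :
    imagePt (f ≫ z) = imagePt z := by
  rw [imagePt_comp]
  exact congrArg z.left (Subsingleton.elim (α := Spec (.of L)) _ _)

variable [LocallyOfFiniteType G.hom]

theorem jacobsonSpace_tensor (L : Type u) [Field L] [Algebra k L] :
    JacobsonSpace (G ⊗ specOver k L).left :=
  have : LocallyOfFiniteType (pullback.snd G.hom (specOver k L).hom) := inferInstance
  have : JacobsonSpace (specOver k L).left := inferInstanceAs (JacobsonSpace (Spec (.of L)))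
  LocallyOfFiniteType.jacobsonSpace (pullback.snd G.hom (specOver k L).hom)

/-- A closed point of `G_k̄` is given by a `k̄`-point of `G`. -/
theorem exists_imagePt_eq [IsAlgClosed kbar] (y : (G ⊗ specOver k kbar).left) (hy : IsClosed {y}) :
    ∃ a : specOver k kbar ⟶ G, imagePt (lift a (𝟙 _)) = y := by
  let r : (G ⊗ specOver k kbar).left ⟶ Spec (.of kbar) := (snd G (specOver k kbar)).left
  have : LocallyOfFiniteType r :=
    inferInstanceAs (LocallyOfFiniteType (pullback.snd G.hom (specOver k kbar).hom))
  let p := pointOfClosedPoint r y hy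
  have hp : p ≫ r = 𝟙 _ := pointOfClosedPoint_comp r y hy
  let p' : specOver k kbar ⟶ G ⊗ specOver k kbar := Over.homMk p (by
    rw [← Over.w (snd G (specOver k kbar))]
    change p ≫ r ≫ _ = _
    rw [reassoc_of% hp])
  refine ⟨p' ≫ fst G _, ?_⟩
  have : lift (p' ≫ fst G _) (𝟙 _) = p' := by
    ext1
    · simp
    · rw [lift_snd]
      ext1
      exact hp.symm
  rw [this]
  exact pointOfClosedPoint_apply r y hy _

end ClosedPoints

section Cover

variable {k : Type u} [Field k] {G : Over (Spec (.of k))} [GrpObj G]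

theorem isAffineOpen_preimage_bitranslate {A : Type u} [CommRing A] [Algebra k A]
    (a b : specOver k A ⟶ G) {U : G.left.Opens} (hU : IsAffineOpen U) :
    IsAffineOpen ((bitranslate a b).left ⁻¹ᵁ U) := by
  have h : bitranslate a b = lift (bitranslate a b) (snd G _) ≫ fst G _ := (lift_fst _ _).symm
  have h₁ : IsIso (lift (bitranslate a b) (snd G (specOver k A))).left :=
    inferInstanceAs (IsIso ((Over.forget _).map (lift (bitranslate a b) (snd G (specOver k A)))))
  have : IsAffineHom (specOver k A).hom :=
    inferInstanceAs (IsAffineHom (Spec.map (CommRingCat.ofHom (algebraMap k A))))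
  have h₂ : IsAffineHom (fst G (specOver k A)).left :=
    MorphismProperty.of_isPullback (P := @IsAffineHom)
      (IsPullback.of_hasPullback G.hom (specOver k A).hom).flip this
  rw [h, Over.comp_left]
  exact hU.preimage _

/-- Up to an automorphism of `G_A` the map is the projection `G_A → G`. It is open, being a base
change of a field extension, and open maps pull dense sets back to dense sets. -/
theorem dense_preimage_bitranslate {A : Type u} [Field A] [Algebra k A]
    (a b : specOver k A ⟶ G) {U : G.left.Opens} (hU : Dense (U : Set G.left)) :
    Dense ((bitranslate a b).left ⁻¹' U) := by
  have h : bitranslate a b = lift (bitranslate a b) (snd G _) ≫ fst G _ := (lift_fst _ _).symm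
  have h₁ : IsIso (lift (bitranslate a b) (snd G (specOver k A))).left :=
    inferInstanceAs (IsIso ((Over.forget _).map (lift (bitranslate a b) (snd G (specOver k A)))))
  have : UniversallyOpen (specOver k A).hom :=
    inferInstanceAs (UniversallyOpen (Y := Spec (.of k)) _)
  have h₂ : UniversallyOpen (fst G (specOver k A)).left :=
    inferInstanceAs (UniversallyOpen (pullback.fst G.hom (specOver k A).hom))
  have h₃ : UniversallyOpen (bitranslate a b).left := by
    rw [h, Over.comp_left]
    infer_instance
  exact hU.preimage (bitranslate a b).left.isOpenMap

variable {kbar : Type u} [Field kbar] [Algebra k kbar] [LocallyOfFiniteType G.hom]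

/-- Finitely many points of `G(k̄)` can be translated into a dense open subset. -/
theorem exists_mul_mem [IsAlgClosed kbar] {U : G.left.Opens} (hU : Dense (U : Set G.left))
    {B : Set (specOver k kbar ⟶ G)} (hB : B.Finite) :
    ∃ h : specOver k kbar ⟶ G, ∀ b ∈ B, imagePt (h * b) ∈ U := by
  -- The `h` with `h b ∈ U` for all `b ∈ B`: a finite intersection of dense opens. By the Jacobson
  -- property it contains a closed point, which is a `k̄`-point.
  let W : Set (G ⊗ specOver k kbar).left := ⋂ b ∈ B, (bitranslate 1 b⁻¹).left ⁻¹' U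
  have hopen (b : specOver k kbar ⟶ G) : IsOpen ((bitranslate 1 b⁻¹).left ⁻¹' U) :=
    U.2.preimage (bitranslate 1 b⁻¹).left.continuous
  have hW : Dense W := by
    dsimp only [W]
    rw [← Set.sInter_image]
    refine (hB.image _).dense_sInter ?_ ?_
    · rintro _ ⟨b, -, rfl⟩
      exact hopen b
    · rintro _ ⟨b, -, rfl⟩
      exact dense_preimage_bitranslate _ _ hU
  have hWo : IsOpen W := hB.isOpen_biInter fun b _ ↦ hopen b
  have : Nonempty (G ⊗ specOver k kbar).left := ⟨imagePt (lift 1 (𝟙 _))⟩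
  have := jacobsonSpace_tensor (G := G) kbar
  obtain ⟨y, hy, hyc⟩ := nonempty_inter_closedPoints hW.nonempty hWo.isLocallyClosed
  obtain ⟨h, rfl⟩ := exists_imagePt_eq y hyc
  refine ⟨h, fun b hb ↦ ?_⟩
  have := Set.mem_iInter₂.mp hy b hb
  rw [Set.mem_preimage, ← imagePt_comp, lift_bitranslate] at this
  simpa using this

end Cover

end QuotStack

end

noncomputable section

namespace QuotStack

/-! ### The cover by stable affine opens -/

section StableCover

theorem isIso_iter {C : Type*} [Category* C] {X : C} (f : X ⟶ X) [IsIso f] (n : ℕ) :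
    IsIso (iter f n) := by
  induction n with
  | zero => exact inferInstanceAs (IsIso (𝟙 X))
  | succ n ih => exact inferInstanceAs (IsIso (f ≫ iter f n))

variable {k k' : Type u} [Field k] [Field k'] [Algebra k k']

theorem isIso_frob [Fintype k'] (L : Type u) [Field L] [Algebra k' L] [Algebra k L]
    [IsScalarTower k k' L] [Algebra.IsAlgebraic k' L] : IsIso (frob k k' L) := by
  let e := (FiniteField.frobeniusAlgEquivOfAlgebraic k' L).restrictScalars k
  have he : frob k k' L = specMap (e : L →ₐ[k] L) := rfl
  rw [he]
  refine ⟨specMap (e.symm : L →ₐ[k] L), ?_, ?_⟩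
  · rw [← specMap_comp, ← specMap_id]
    congr 1
    ext a
    exact e.apply_symm_apply a
  · rw [← specMap_comp, ← specMap_id]
    congr 1
    ext a
    exact e.symm_apply_apply a

variable {G : Over (Spec (.of k))}

section StableOpen

variable [GrpObj G] {K : Type u} [Field K] [Algebra k K] [Algebra k' K] [IsScalarTower k k' K]

/-- Composing with the twist replaces `i` by `i + 1`, by the recursion `g_{i+1} = s(g_i) g`. -/
theorem twist_comp_bitranslate (F : K →ₐ[k'] K) (g h : specOver k K ⟶ G) (i : ℕ) :
    twist F g ≫ bitranslate (iter (specMap (F.restrictScalars k)) i ≫ h)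
        (normIter (specMap (F.restrictScalars k)) g i) =
      bitranslate (iter (specMap (F.restrictScalars k)) (i + 1) ≫ h)
        (normIter (specMap (F.restrictScalars k)) g (i + 1)) := by
  rw [twist, lift_bitranslate]
  simp only [bitranslate, iter, normIter, MonObj.comp_mul, Category.assoc, mul_inv_rev, mul_assoc]

/-- The points all of whose images under the powers of a twist are moved by `h` into `U`. -/
def stableOpen (F : K →ₐ[k'] K) (g h : specOver k K ⟶ G) (U : G.left.Opens) (N : ℕ) :
    (G ⊗ specOver k K).left.Opens :=
  ⨅ i : Fin N, (bitranslate (iter (specMap (F.restrictScalars k)) i ≫ h)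
    (normIter (specMap (F.restrictScalars k)) g i)).left ⁻¹ᵁ U

theorem mem_stableOpen {F : K →ₐ[k'] K} {g h : specOver k K ⟶ G} {U : G.left.Opens} {N : ℕ}
    {y : (G ⊗ specOver k K).left} : y ∈ stableOpen F g h U N ↔
      ∀ i < N, (bitranslate (iter (specMap (F.restrictScalars k)) i ≫ h)
        (normIter (specMap (F.restrictScalars k)) g i)).left y ∈ U := by
  rw [stableOpen, ← SetLike.mem_coe, TopologicalSpace.Opens.coe_iInf, Set.mem_iInter]
  exact ⟨fun h i hi ↦ h ⟨i, hi⟩, fun h i ↦ h i i.2⟩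

theorem isAffineOpen_stableOpen (F : K →ₐ[k'] K) (g h : specOver k K ⟶ G) {U : G.left.Opens}
    (hU : IsAffineOpen U) (N : ℕ) [NeZero N] : IsAffineOpen (stableOpen F g h U N) := by
  rw [stableOpen, ← Finset.inf'_univ_eq_ciInf]
  exact Finset.inf'_induction _ _ (fun _ h₁ _ h₂ ↦ isAffineOpen_inf G K h₁ h₂)
    fun i _ ↦ isAffineOpen_preimage_bitranslate _ _ hU

/-- The twist shifts the index `i` of the defining conditions by one, and the conditions for `0` and
`N` coincide because `s^N = 1` and `g_N = 1`. -/
theorem preimage_stableOpen (F : K →ₐ[k'] K) (g h : specOver k K ⟶ G) (U : G.left.Opens)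
    {N : ℕ} [NeZero N] (hF : iter (specMap (F.restrictScalars k)) N = 𝟙 (specOver k K))
    (hg : normIter (specMap (F.restrictScalars k)) g N = 1) :
    (twist F g).left ⁻¹ᵁ stableOpen F g h U N = stableOpen F g h U N := by
  have key (y : (G ⊗ specOver k K).left) (i : ℕ) :
      (bitranslate (iter (specMap (F.restrictScalars k)) i ≫ h)
        (normIter (specMap (F.restrictScalars k)) g i)).left ((twist F g).left y) =
      (bitranslate (iter (specMap (F.restrictScalars k)) (i + 1) ≫ h)
        (normIter (specMap (F.restrictScalars k)) g (i + 1))).left y := by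
    rw [← twist_comp_bitranslate, Over.comp_left]
    rfl
  ext y
  change (twist F g).left y ∈ stableOpen F g h U N ↔ y ∈ stableOpen F g h U N
  simp only [mem_stableOpen, key]
  constructor
  · intro H i hi
    rcases i with _ | i
    · have := H (N - 1) (Nat.sub_one_lt (NeZero.ne N))
      rw [Nat.sub_add_cancel (NeZero.one_le), hF, hg] at this
      simpa only [iter, normIter] using this
    · exact H i (Nat.lt_of_succ_lt hi)
  · intro H i hi
    rcases (Nat.succ_le_iff.mpr hi).lt_or_eq with h' | h'
    · exact H (i + 1) h'
    · have := H 0 (Nat.pos_of_neZero N)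
      change i + 1 = N at h'
      rw [h', hF, hg]
      simpa only [iter, normIter] using this

end StableOpen

variable {kbar : Type u} [Field kbar] [Algebra k kbar] [Algebra k' kbar] [IsScalarTower k k' kbar]
  [Algebra.IsAlgebraic k' kbar]

/-- Two geometric points, hence all points obtained from them by the Frobenius and the group law,
lie in the finite set of points over a finite extension. -/
theorem exists_common_level [LocallyOfFiniteType G.hom]
    (a g : specOver k kbar ⟶ G) :
    ∃ (K : IntermediateField k' kbar) (_ : FiniteDimensional k' K) (a' g' : specOver k K ⟶ G),
      subMap K ≫ a' = a ∧ subMap K ≫ g' = g := by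
  obtain ⟨K₁, _, a₁, rfl⟩ := exists_finite_level (k' := k') a
  obtain ⟨K₂, _, g₂, rfl⟩ := exists_finite_level (k' := k') g
  obtain ⟨a', ha'⟩ := exists_subMap_comp_eq_of_le (le_sup_left : K₁ ≤ K₁ ⊔ K₂) a₁
  obtain ⟨g', hg'⟩ := exists_subMap_comp_eq_of_le (le_sup_right : K₂ ≤ K₁ ⊔ K₂) g₂
  exact ⟨K₁ ⊔ K₂, inferInstance, a', g', ha', hg'⟩

variable [GrpObj G] [Fintype k'] [LocallyOfFiniteType G.hom] [QuasiCompact G.hom]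

-- Both `h` and `g` live over one finite extension `K` of `k'`, so all the pairs come from the
-- finite set `G(K) × G(K)`.
variable (k') in
theorem finite_range_iter_normIter (h g : specOver k kbar ⟶ G) :
    (Set.range fun i ↦ (iter (frob k k' kbar) i ≫ h, normIter (frob k k' kbar) g i)).Finite := by
  obtain ⟨K, _, h', g', rfl, rfl⟩ := exists_common_level (k' := k') h g
  have : Finite K := Module.finite_of_finite k'
  have := finite_points G K
  refine (Set.finite_range fun z : (specOver k K ⟶ G) × (specOver k K ⟶ G) ↦
    (subMap K ≫ z.1, subMap K ≫ z.2)).subset ?_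
  rintro _ ⟨i, rfl⟩
  refine ⟨(iter (frob k k' K) i ≫ h', normIter (frob k k' K) g' i), ?_⟩
  dsimp only
  rw [comp_normIter (subMap_frob K), ← Category.assoc, ← comp_iter (subMap_frob K), Category.assoc]

/-- Finitely many of the open sets of points moved by some `h` into `U` under all powers of the
twist cover `G_k̄`. -/
theorem exists_finite_cover [IsAlgClosed kbar] (g : specOver k kbar ⟶ G) {U : G.left.Opens}
    (hU : Dense (U : Set G.left)) : ∃ t : Finset (specOver k kbar ⟶ G),
      ∀ y : (G ⊗ specOver k kbar).left, ∃ h ∈ t, ∀ i,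
        (bitranslate (iter (frob k k' kbar) i ≫ h) (normIter (frob k k' kbar) g i)).left y ∈ U := by
  let W (h : specOver k kbar ⟶ G) : Set (G ⊗ specOver k kbar).left :=
    ⋂ i, (bitranslate (iter (frob k k' kbar) i ≫ h) (normIter (frob k k' kbar) g i)).left ⁻¹' U
  have hW (h) : IsOpen (W h) := by
    -- The intersection over all `i` involves only finitely many distinct translations, hence is
    -- open.
    have := (finite_range_iter_normIter k' h g).isOpen_biInter (f := fun c : (specOver k kbar ⟶ G) ×
      (specOver k kbar ⟶ G) ↦ (bitranslate c.1 c.2).left ⁻¹' U) fun c _ ↦ U.2.preimage (bitranslate c.1 c.2).left.continuous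
    rwa [Set.biInter_range] at this
  have hcov : Set.univ ⊆ ⋃ h, W h := by
    by_contra hne
    have := jacobsonSpace_tensor (G := G) kbar
    obtain ⟨y, hy, hyc⟩ := nonempty_inter_closedPoints
      (Set.nonempty_compl.mpr fun h ↦ hne h.ge)
      (isOpen_iUnion hW).isClosed_compl.isLocallyClosed
    obtain ⟨a, rfl⟩ := exists_imagePt_eq y hyc
    obtain ⟨K, _, a', g', rfl, rfl⟩ := exists_common_level (k' := k') a g
    have : Finite K := Module.finite_of_finite k'
    have := finite_points G K
    obtain ⟨h, hh⟩ := exists_mul_mem hU (Set.finite_range fun z : specOver k K ⟶ G ↦ subMap K ≫ z)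
    refine hy (Set.mem_iUnion.mpr ⟨h, Set.mem_iInter.mpr fun i ↦ ?_⟩)
    rw [Set.mem_preimage, ← imagePt_comp, lift_bitranslate, Category.id_comp, Category.id_comp]
    have := isIso_frob (k := k) (k' := k') K
    have := isIso_iter (frob k k' K) i
    -- Pulling `s^i` out gives `s^i(h) a g_i⁻¹ = s^i(h w)` with `w ∈ G(K)`. As `U` is open in `G`
    -- itself, `s^i` does not matter, and a single `h` serves all `w` in the finite set `G(K)`.
    let w := inv (iter (frob k k' K) i) ≫ (a' * (normIter (frob k k' K) g' i)⁻¹)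
    have hw : (iter (frob k k' kbar) i ≫ h) * (subMap K ≫ a') *
        (normIter (frob k k' kbar) (subMap K ≫ g') i)⁻¹ =
        iter (frob k k' kbar) i ≫ (h * (subMap K ≫ w)) := by
      rw [MonObj.comp_mul, ← Category.assoc _ (subMap K), comp_iter (subMap_frob K), Category.assoc,
        IsIso.hom_inv_id_assoc, MonObj.comp_mul, GrpObj.comp_inv, comp_normIter (subMap_frob K),
        mul_assoc]
    rw [hw, iter_frob, imagePt_specMap]
    exact hh _ ⟨w, rfl⟩
  have : QuasiCompact (pullback.snd G.hom (specOver k kbar).hom) := inferInstance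
  have : CompactSpace (G ⊗ specOver k kbar).left :=
    (quasiCompact_iff_compactSpace (Y := Spec (.of kbar))
      (pullback.snd G.hom (specOver k kbar).hom)).mp this
  obtain ⟨t, ht⟩ := isCompact_univ.elim_finite_subcover W hW hcov
  refine ⟨t, fun y ↦ ?_⟩
  obtain ⟨h, hh, hy⟩ := Set.mem_iUnion₂.mp (ht (Set.mem_univ y))
  exact ⟨h, hh, Set.mem_iInter.mp hy⟩

end StableCover

end QuotStack

end

noncomputable section

namespace QuotStack

/-! ### Sections of torsors and trivializations -/

section Categorical

variable {C : Type w} [Category.{v} C] [CartesianMonoidalCategory C] {G : C} [MonObj G]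

theorem translationAction_smul_fst {S Z : C} (g : Z ⟶ G) (t : Z ⟶ G ⊗ S) :
    letI := translationAction G S
    (g • t) ≫ fst G S = g * (t ≫ fst G S) := by
  change (lift g t ≫ lift _ _) ≫ _ = _
  simp [MonObj.comp_mul]

theorem translationAction_smul_snd {S Z : C} (g : Z ⟶ G) (t : Z ⟶ G ⊗ S) :
    letI := translationAction G S
    (g • t) ≫ snd G S = t ≫ snd G S := by
  change (lift g t ≫ lift _ _) ≫ _ = _
  simp

variable {T S S' Z : C} [ModObj G T] (π : T ⟶ S) (s : S' ⟶ S) [HasPullback π s]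
  (h : γ[G, T] ≫ π = snd G T ≫ π) (g : Z ⟶ G) (t : Z ⟶ pullback π s)

theorem pullbackAction_smul_fst :
    letI := pullbackAction π s h
    (g • t) ≫ pullback.fst π s = g • (t ≫ pullback.fst π s) := by
  change (lift g t ≫ pullback.lift _ _ _) ≫ _ = _
  simp only [Category.assoc, pullback.lift_fst, ModObj.comp_smul, lift_fst, lift_snd_assoc]

theorem pullbackAction_smul_snd :
    letI := pullbackAction π s h
    (g • t) ≫ pullback.snd π s = t ≫ pullback.snd π s := by
  change (lift g t ≫ pullback.lift _ _ _) ≫ _ = _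
  simp only [Category.assoc, pullback.lift_snd, lift_snd_assoc]

end Categorical

namespace QuotientStack

variable {k : Type u} [Field k] {G X : Over (Spec (.of k))} [GrpObj G] [ModObj G X]
  {S S' : Over (Spec (.of k))}

/-- A section over `S'` of the torsor of an object over `S` trivializes its pullback to `S'`. -/
theorem ofPoint_iso_baseChange [LocallyOfFiniteType G.hom] (M : QuotientStack G X S) (s : S' ⟶ S)
    (t : S' ⟶ M.T) (ht : t ≫ M.π = s) :
    Nonempty (ofPoint (G := G) (t ≫ M.f) ≅ M.baseChange s) := by
  obtain ⟨hinv, huniq⟩ := (isPullback_iff M.π).mp M.torsor.isPullback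
  have hinv' {Z : Over (Spec (.of k))} (g : Z ⟶ G) (b : Z ⟶ M.T) : (g • b) ≫ M.π = b ≫ M.π := by
    rw [Hom.smul_def, Category.assoc, hinv, lift_snd_assoc]
  let a : G ⊗ S' ⟶ pullback M.π s := pullback.lift (fst G S' • (snd G S' ≫ t)) (snd G S') (by
    rw [hinv', Category.assoc, ht])
  obtain ⟨d, hd, -⟩ := huniq (pullback.fst M.π s) (pullback.snd M.π s ≫ t) (by
    rw [Category.assoc, ht, pullback.condition])
  let b : pullback M.π s ⟶ G ⊗ S' := lift d (pullback.snd M.π s)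
  have hba : b ≫ a = 𝟙 _ := by
    apply pullback.hom_ext
    · rw [Category.assoc, pullback.lift_fst, ModObj.comp_smul, lift_fst, lift_snd_assoc,
        Category.id_comp]
      exact hd
    · rw [Category.assoc, pullback.lift_snd, lift_snd, Category.id_comp]
  have hab : a ≫ b = 𝟙 _ := by
    ext1
    · have hd' : d • (pullback.snd M.π s ≫ t) = pullback.fst M.π s := hd
      rw [Category.assoc, lift_fst, Category.id_comp]
      refine (huniq (fst G S' • (snd G S' ≫ t)) (snd G S' ≫ t) (hinv' _ _)).unique ?_ rfl
      have h : a ≫ (d • (pullback.snd M.π s ≫ t)) = a ≫ pullback.fst M.π s := by rw [hd']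
      rwa [ModObj.comp_smul, ← Category.assoc, pullback.lift_snd, pullback.lift_fst] at h
    · rw [Category.assoc, lift_snd, Category.id_comp]
      exact pullback.lift_snd _ _ _
  let := translationAction G S'
  let := pullbackAction M.π s hinv
  have ha : IsModHom G a := isModHom_of_points _ fun {Z} g z ↦ by
    apply pullback.hom_ext
    · rw [pullbackAction_smul_fst, Category.assoc, Category.assoc, pullback.lift_fst,
        ModObj.comp_smul, ModObj.comp_smul, translationAction_smul_fst, ← Category.assoc (g • z),
        translationAction_smul_snd, mul_smul, Category.assoc]
    · rw [pullbackAction_smul_snd, Category.assoc, Category.assoc, pullback.lift_snd,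
        translationAction_smul_snd]
  have hb : IsModHom G b := isModHom_of_points _ fun {Z} g z ↦ by
    have : Mono a := mono_of_mono_fac hab
    rw [← cancel_mono a, IsModHom.map_smul a, Category.assoc, Category.assoc, hba, Category.comp_id,
      Category.comp_id]
  have haπ : a ≫ pullback.snd M.π s = snd G S' := pullback.lift_snd _ _ _
  have haf : a ≫ pullback.fst M.π s ≫ M.f = fst G S' • (snd G S' ≫ t ≫ M.f) := by
    rw [pullback.lift_fst_assoc, IsModHom.map_smul, Category.assoc]
  have hbπ : b ≫ snd G S' = pullback.snd M.π s := lift_snd _ _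
  have hbf : b ≫ (fst G S' • (snd G S' ≫ t ≫ M.f)) = pullback.fst M.π s ≫ M.f := by
    rw [← haf, reassoc_of% hba]
  exact ⟨{
    hom := ⟨a, ha, haπ, haf⟩
    inv := ⟨b, hb, hbπ, hbf⟩
    hom_inv_id := Hom.ext hab
    inv_hom_id := Hom.ext hba }⟩

/-- The point is the image of the unit section under the inverse of the trivialization. -/
theorem exists_point_of_iso [LocallyOfFiniteType G.hom] (M : QuotientStack G X S) (s : S' ⟶ S)
    (x : S' ⟶ X) (e : M.baseChange s ≅ ofPoint (G := G) x) :
    ∃ t : S' ⟶ M.T, t ≫ M.π = s ∧ t ≫ M.f = x := by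
  let a : G ⊗ S' ⟶ pullback M.π s := e.inv.hom
  have hπ : a ≫ pullback.snd M.π s = snd G S' := e.inv.hom_π
  have hf : a ≫ pullback.fst M.π s ≫ M.f = fst G S' • (snd G S' ≫ x) := e.inv.hom_f
  refine ⟨lift 1 (𝟙 S') ≫ a ≫ pullback.fst M.π s, ?_, ?_⟩
  · rw [Category.assoc, Category.assoc, pullback.condition, reassoc_of% hπ, lift_snd_assoc,
      Category.id_comp]
  · rw [Category.assoc, Category.assoc, hf, ModObj.comp_smul, lift_fst, lift_snd_assoc, one_smul,
      Category.id_comp]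

end QuotientStack

/-! ### Construction of the model -/

section Model

variable {k k' kbar : Type u} [Field k] [Field k'] [Field kbar] [Algebra k k'] [Algebra k kbar]
  [Algebra k' kbar] [IsScalarTower k k' kbar]
theorem surjective_whiskerLeft (G : Over (Spec (.of k)))
    (K : IntermediateField k' kbar) :
    Function.Surjective (G ◁ subMap (k := k) K).left := by
  have h := (isPullback_whiskerLeft_snd G (subMap (k := k) K)).map (Over.forget _)
  have h₁ : Surjective (subMap (k := k) K).left :=
    ⟨Function.surjective_to_subsingleton (α := Spec (.of kbar)) (β := Spec (.of K)) _⟩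
  have h₂ : Surjective (G ◁ subMap (k := k) K).left :=
    MorphismProperty.of_isPullback (P := @Surjective) h.flip h₁
  exact h₂.surj

variable {G X : Over (Spec (.of k))} [GrpObj G] [ModObj G X]

theorem whiskerLeft_comp_bitranslate {S S' : Over (Spec (.of k))} (j : S' ⟶ S) (a b : S ⟶ G) :
    G ◁ j ≫ bitranslate a b = bitranslate (j ≫ a) (j ≫ b) := by
  simp [bitranslate, MonObj.comp_mul, GrpObj.comp_inv]

theorem iter_left {Z : Over (Spec (.of k))} (f : Z ⟶ Z) (n : ℕ) :
    (iter f n).left = iter f.left n := by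
  induction n with
  | zero => rfl
  | succ n ih => rw [iter, iter, Over.comp_left, ih]

/-- A geometric point whose orbit is fixed by the Frobenius of `k'` comes from an object over `k'`. -/
theorem exists_model [Fintype k'] [IsAlgClosed kbar] [Algebra.IsAlgebraic k' kbar]
    [LocallyOfFiniteType G.hom] [QuasiCompact G.hom] (x : specOver k kbar ⟶ X)
    (g : specOver k kbar ⟶ G) (hx : frob k k' kbar ≫ x = g • x) :
    ∃ (M : QuotientStack G X (specOver k k')) (t : specOver k kbar ⟶ M.T),
      t ≫ M.π = towerMap k k' kbar ∧ t ≫ M.f = x := by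
  have := isIso_frob (k := k) (k' := k') kbar
  obtain ⟨n, hn, hdvd⟩ := exists_normIter_eq_one (frob k k' kbar) g (by
    refine ((finite_range_iter_normIter k' g g).image Prod.snd).subset ?_
    rintro _ ⟨i, rfl⟩
    exact ⟨_, ⟨i, rfl⟩, rfl⟩)
  obtain ⟨K₁, _, x₁, hx₁⟩ := exists_finite_level_of_frob (k' := k') x hn (by
    rw [iter_comp_eq_smul hx, hdvd n dvd_rfl, one_smul])
  obtain ⟨K₂, _, g₂, hg₂⟩ := exists_finite_level (k' := k') g
  have : IsLocallyNoetherian G.left := LocallyOfFiniteType.isLocallyNoetherian G.hom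
  have : CompactSpace G.left := (quasiCompact_iff_compactSpace (f := G.hom)).mp ‹_›
  have : IsNoetherian G.left := {}
  obtain ⟨U, hU, hUd⟩ := exists_dense_isAffineOpen G.left
  obtain ⟨s, hs⟩ := exists_finite_cover (k' := k') g hUd
  choose L hL z hz using fun h : s ↦ exists_finite_level (k' := k') h.1
  have : NeZero n := ⟨hn.ne'⟩
  -- Including a subextension of degree `n` in `K` ensures `n ∣ [K : k']`, so that the norm of
  -- length `[K : k']` is `1`.
  obtain ⟨K₄, _, hK₄⟩ := exists_finrank_eq k' kbar n
  let K := (K₁ ⊔ K₂) ⊔ ((⨆ h, L h) ⊔ K₄)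
  have hK : FiniteDimensional k' K := inferInstance
  obtain ⟨x', hx'⟩ := exists_subMap_comp_eq_of_le (L := K) (le_sup_left.trans le_sup_left) x₁
  obtain ⟨g', hg'⟩ := exists_subMap_comp_eq_of_le (L := K) (le_sup_right.trans le_sup_left) g₂
  have hh (h : s) := exists_subMap_comp_eq_of_le (L := K)
    ((le_iSup L h).trans (le_sup_left.trans le_sup_right)) (z h)
  rw [hx₁] at hx'
  rw [hg₂] at hg'
  have hepi : Epi (subMap (k := k) K) := epi_specMap _
  have hfin : Finite K := Module.finite_of_finite k'
  let N := Module.finrank k' K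
  have hN : NeZero N := ⟨Module.finrank_pos.ne'⟩
  have hnN : n ∣ N := hK₄ ▸ IntermediateField.finrank_dvd_of_le_right
    (le_sup_right.trans le_sup_right : K₄ ≤ K)
  let F := FiniteField.frobeniusAlgHom k' K
  have hF : orderOf F = N := FiniteField.orderOf_frobeniusAlgHom k' K
  have hxg : frob k k' K ≫ x' = g' • x' := by
    rw [← cancel_epi (subMap (k := k) K), ModObj.comp_smul, ← Category.assoc, ← subMap_frob,
      Category.assoc, hx', hg', hx]
  have hnorm : normIter (frob k k' K) g' N = 1 := by
    rw [← cancel_epi (subMap (k := k) K), comp_normIter (subMap_frob K), hg', hdvd N hnN,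
      MonObj.comp_one]
  have hiter : iter (frob k k' K) N = 𝟙 _ := by
    rw [iter_frob, ← hF, pow_orderOf_eq_one]
    exact specMap_id _
  have htwist : iter (twist F g') N = 𝟙 _ := by
    rw [iter_twist, hnorm, hiter, MonObj.comp_one, inv_one, mul_one, Category.comp_id, lift_fst_snd]
  have hsnd : twist F g' ≫ snd G _ = snd G _ ≫ frob k k' K := lift_snd _ _
  obtain ⟨T, π, p, hp, hpb⟩ := exists_quotient (φ := (twist F g').left) (N := N) rfl F hF
    (snd G (specOver k K)).left (congrArg (·.left) hsnd)
    (by rw [← iter_left, htwist]; rfl) (fun _ _ ↦ isAffineOpen_inf G K) (fun y ↦ by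
      -- A point of `G_K` is lifted to `G_k̄`, where one of the finitely many `h` serves; that `h`
      -- is defined over `K` by the choice of `K`.
      obtain ⟨y, rfl⟩ := surjective_whiskerLeft G K y
      obtain ⟨h, hhs, hy⟩ := hs y
      obtain ⟨h', hh'⟩ := hh ⟨h, hhs⟩
      rw [hz] at hh'
      refine ⟨⟨stableOpen F g' h' U N, isAffineOpen_stableOpen F g' h' hU N,
        preimage_stableOpen F g' h' U hiter hnorm⟩, mem_stableOpen.mpr fun i _ ↦ ?_⟩
      have e : G ◁ subMap K ≫ bitranslate (iter (frob k k' K) i ≫ h')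
          (normIter (frob k k' K) g' i) =
          bitranslate (iter (frob k k' kbar) i ≫ h) (normIter (frob k k' kbar) g i) := by
        rw [whiskerLeft_comp_bitranslate, comp_normIter (subMap_frob K), hg', ← Category.assoc,
          ← comp_iter (subMap_frob K), Category.assoc, hh']
      have := hy i
      rw [← e, Over.comp_left] at this
      exact this)
  let T' : Over (Spec (.of k)) := Over.mk (π ≫ (specOver k k').hom)
  let π' : T' ⟶ specOver k k' := Over.homMk π
  let p' : G ⊗ specOver k K ⟶ T' := Over.homMk p (by
    change p ≫ π ≫ _ = _
    rw [← Over.w (snd G (specOver k K)), ← Category.assoc, hpb.w, Category.assoc,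
      ← Over.w (towerMap k k' K)]
    rfl)
  have hp' : twist F g' ≫ p' = p' := by
    ext1
    exact hp
  have hpb' : IsPullback p' (snd G _) π' (towerMap k k' K) :=
    IsPullback.of_map (Over.forget _) (by ext1; exact hpb.w) hpb
  obtain ⟨M, t, htπ, htf⟩ := exists_quotientStack_of_descent (N := N) rfl F hF x' g' hxg π' p' hp' hpb'
  refine ⟨M, subMap K ≫ t, ?_, ?_⟩
  · rw [Category.assoc, htπ, ← specMap_comp]
    rfl
  · rw [Category.assoc, htf, hx']

end Model

end QuotStack

end

/-! ### The equivalence -/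

theorem mainTheorem5 {k : Type u} [Field k] [Finite k]
    (G : Over (Spec (.of k))) [GrpObj G] [LocallyOfFiniteType G.hom] [QuasiCompact G.hom]
    (X : Over (Spec (.of k))) [ModObj G X]
    (kbar : Type u) [Field kbar] [Algebra k kbar] [IsAlgClosure k kbar]
    (C : QuotStack.Orbits G X kbar)
    (k' : Type u) [Field k'] [Algebra k k'] [FiniteDimensional k k']
    [Algebra k' kbar] [IsScalarTower k k' kbar] :
    QuotStack.HasModel k' (QuotStack.P C) ↔ ∀ σ : Gal(kbar/k'), σ.restrictScalars k • C = C := by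
  induction C using Quotient.inductionOn with | h x => ?_
  constructor
  · rintro ⟨M, hM⟩ σ
    obtain ⟨e⟩ := Quotient.exact hM
    obtain ⟨t, htπ, htf⟩ := M.exists_point_of_iso _ x e
    let σ' : kbar →ₐ[k] kbar := (σ.restrictScalars k : Gal(kbar/k))
    have hσ : QuotStack.specMap σ' ≫ QuotStack.specMap (IsScalarTower.toAlgHom k k' kbar) =
        QuotStack.specMap (IsScalarTower.toAlgHom k k' kbar) := by
      rw [← QuotStack.specMap_comp]
      congr 1
      ext a
      exact σ.commutes a
    -- `σ t` and `t` have the same image in `Spec k'`, so simple transitivity gives `h` with `h t =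
    -- σ t`; applying `M.f` yields `h x = σ x`.
    obtain ⟨h, hh, -⟩ := ((QuotStack.isPullback_iff M.π).mp M.torsor.isPullback).2
      (QuotStack.specMap σ' ≫ t) t (by rw [Category.assoc, htπ, hσ])
    refine Quotient.sound ⟨h, ?_⟩
    change h • x = QuotStack.specMap σ' ≫ x
    rw [← htf, ← Category.assoc, ← IsModHom.map_smul]
    exact congrArg (· ≫ M.f) hh
  · intro hC
    have : IsAlgClosed kbar := IsAlgClosure.isAlgClosed k
    have : Algebra.IsAlgebraic k kbar := IsAlgClosure.isAlgebraic
    have : Algebra.IsAlgebraic k' kbar := Algebra.IsAlgebraic.tower_top (K := k) k'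
    have : Finite k' := Module.finite_of_finite k
    have := Fintype.ofFinite k'
    -- Only invariance under the Frobenius of `k'` is needed.
    obtain ⟨g, hg⟩ := Quotient.exact (hC (FiniteField.frobeniusAlgEquivOfAlgebraic k' kbar))
    obtain ⟨M, t, htπ, rfl⟩ := QuotStack.exists_model (k' := k') x g hg.symm
    obtain ⟨e⟩ := M.ofPoint_iso_baseChange _ t htπ
    exact ⟨M, Quotient.sound ⟨e.symm⟩⟩
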